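/- Let $K$ be a number field with ring of integers $\mathcal{O}_K$. A *rigid adelic space* over $K$ is a finite-dimensional $K$-vector space $E$ together with an $\mathcal{O}_K$-lattice $L\subset E$ (finitely generated, spanning $E$ over $K$) and, for every embedding $\gamma:K\to\mathbf{C}$, a positive definite Hermitian form $h_\gamma$ on $E\otimes_\gamma\mathbf{C}$, with $h_{\overline{\gamma}}(x,y)=\overline{h_\gamma(x,y)}$ for $x,y\in E$. It defines local norms: $\Vert x\Vert_v=\sqrt{h_\gamma(x,x)}$ if $v$ is the infinite place given by $\gamma$, and $\Vert x\Vert_v=\inf\{|\alpha|_v : x\in\alpha L_v\}$ if $v$ is finite. If $L=\bigoplus_i\mathfrak{a}_ib_i$ with fractional ideals $\mathfrak a_i$ and a $K$-basis $(b_i)$ of $E$, its height is $$H(E)=\Bigl(N\bigl(\textstyle\prod_i\mathfrak a_i\bigr)\prod_{v\mid\infty}\det(h_v(b_i,b_j))^{e_v/2}\Bigr)^{1/[K:\mathbf{Q}]},$$ with $e_v=1$ for $v$ real and $e_v=2$ for $v$ complex; its reduced height, for $E\ne0$, is $H_r(E)=H(E)^{1/\dim E}$. A subspace $W\subset E$ carries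 the lattice $L\cap W$ and the restricted forms, and for $E\neq0$ $$H_{min}(E)=\min_{0\neq W\subset E}H_r(W).$$ The dual $E^\vee=\operatorname{Hom}_K(E,K)$ carries the lattice $\operatorname{Hom}_{\mathcal{O}_K}(L,\mathcal{O}_K)$ and the dual Hermitian forms (those of the operator norms), and $E\otimes F$ carries the tensor product lattice and the tensor product forms. A *similarity* is a $K$-linear map between rigid adelic spaces that multiplies the local norm at each place $v$ by a constant $\lambda_v>0$, with $\lambda_v=1$ for all but finitely many $v$. A rigid adelic space $E$ is *isodual* if there is a similarity $\sigma:E\to E^\vee$; it is *orthogonal* (resp. *symplectic*) if $\sigma$ can be chosen such that the bilinear form $b_\sigma(x,y)=\sigma(x)(y)$ is symmetric (resp. alternating). If $K$ is a CM field, the conjugate $\overline{V}$ of a rigid adelic space $V$ is the same group with the external law $\alpha\star x=\overline{\alpha}x$, the same lattice, and at $\gamma$ the form of $V$ at $\overline{\gamma}$; $E$ is *unitary* if there is a similarity $\sigma:E\to\overline{E^\vee}$ such that the sesquilinear form $b_\sigma(x,y)=\sigma(x)(y)$ is Hermitian. **Proposition.** Let $F$ be a nonzero rigid adelic space over a number field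 $K$. The following are equivalent: 1. for every nonzero rigid adelic space $E$ over $K$, $H_{min}(E\otimes F)=H_{min}(E)H_{min}(F)$; 2. for every nonzero isodual rigid adelic space $E$ over $K$, $H_{min}(E\otimes F)=H_{min}(E)H_{min}(F)$; 3. for every nonzero orthogonal rigid adelic space $E$ over $K$, $H_{min}(E\otimes F)=H_{min}(E)H_{min}(F)$; 4. for every nonzero symplectic rigid adelic space $E$ over $K$, $H_{min}(E\otimes F)=H_{min}(E)H_{min}(F)$. If $K$ is a CM field, these are also equivalent to: 5. for every nonzero unitary rigid adelic space $E$ over $K$, $H_{min}(E\otimes F)=H_{min}(E)H_{min}(F)$. -/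

import Mathlib

universe u v w

namespace RigidAdelicSpace

open scoped NumberField TensorProduct nonZeroDivisors ComplexConjugate ComplexOrder

section Helpers

theorem exists_smul_mem {R : Type*} {K : Type*} [CommRing R] [IsDomain R] [Field K] [Algebra R K]
    [IsFractionRing R K] {V : Type*} [AddCommGroup V] [Module R V] [Module K V]
    [IsScalarTower R K V] (M : Submodule R V) (hM : Submodule.span K (M : Set V) = ⊤) (x : V) :
    ∃ a : R, a ≠ 0 ∧ a • x ∈ M := by
  have hx : x ∈ Submodule.span K (M : Set V) := hM ▸ Submodule.mem_top
  induction hx using Submodule.span_induction with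
  | mem x hx => exact ⟨1, one_ne_zero, by simpa using hx⟩
  | zero => exact ⟨1, one_ne_zero, by simp⟩
  | add x y _ _ hx hy =>
    obtain ⟨a, ha, hax⟩ := hx
    obtain ⟨b, hb, hby⟩ := hy
    refine ⟨a * b, mul_ne_zero ha hb, ?_⟩
    rw [smul_add]
    refine M.add_mem ?_ ?_
    · rw [mul_comm, mul_smul]; exact M.smul_mem _ hax
    · rw [mul_smul]; exact M.smul_mem _ hby
  | smul c x _ hx =>
    obtain ⟨a, ha, hax⟩ := hx
    obtain ⟨n, d, hd, rfl⟩ := IsFractionRing.div_surjective (A := R) c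
    have hd0 : d ≠ 0 := nonZeroDivisors.ne_zero hd
    have hd1 : algebraMap R K d ≠ 0 := by simpa using hd0
    refine ⟨d * a, mul_ne_zero hd0 ha, ?_⟩
    have : (d * a) • ((algebraMap R K n / algebraMap R K d) • x) = n • (a • x) := by
      rw [← algebraMap_smul K (d * a), ← algebraMap_smul K n, ← algebraMap_smul K a, smul_smul,
        smul_smul, map_mul]
      congr 1
      field_simp
    rw [this]
    exact M.smul_mem _ hax

/-- A common denominator for a `K`-linear form on a finitely generated module. -/
theorem exists_denom {R : Type*} {K : Type*} [CommRing R] [IsDomain R] [Field K] [Algebra R K]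
    [IsFractionRing R K] {V : Type*} [AddCommGroup V] [Module R V] [Module K V]
    [IsScalarTower R K V] (M : Submodule R V) (hM : M.FG) (f : V →ₗ[K] K) :
    ∃ d : R, d ≠ 0 ∧ ∀ x ∈ M, ∃ a : R, f (d • x) = algebraMap R K a := by
  classical
  obtain ⟨s, rfl⟩ := hM
  obtain ⟨d, hd⟩ := IsLocalization.exist_integer_multiples_of_finset R⁰ (s.image f)
  refine ⟨d, nonZeroDivisors.ne_zero d.2, fun x hx => ?_⟩
  induction hx using Submodule.span_induction with
  | mem x hx =>
    obtain ⟨a, ha⟩ := hd (f x) (Finset.mem_image_of_mem _ hx)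
    exact ⟨a, by rw [ha, LinearMap.map_smul_of_tower]⟩
  | zero => exact ⟨0, by simp⟩
  | add x y _ _ hx hy =>
    obtain ⟨a, ha⟩ := hx
    obtain ⟨b, hb⟩ := hy
    exact ⟨a + b, by rw [smul_add, map_add, ha, hb, map_add]⟩
  | smul c x _ hx =>
    obtain ⟨a, ha⟩ := hx
    exact ⟨c * a, by
      rw [smul_comm, LinearMap.map_smul_of_tower, ha, map_mul, Algebra.smul_def]⟩

variable {K : Type*} [Field K] {E : Type*} [AddCommGroup E] [Module K E] {γ : K →+* ℂ}

/-- The Gram matrix of a family of vectors. -/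
def gram (h : E →ₛₗ[(starRingEnd ℂ).comp γ] E →ₛₗ[γ] ℂ) {ι : Type*} (x : ι → E) :
    Matrix ι ι ℂ :=
  Matrix.of fun i j => h (x i) (x j)

theorem gram_change (h : E →ₛₗ[(starRingEnd ℂ).comp γ] E →ₛₗ[γ] ℂ) {ι κ : Type*} [Fintype ι]
    (x : ι → E) (c : Matrix ι κ K) :
    gram h (fun j => ∑ i, c i j • x i) =
      (c.map γ).conjTranspose * gram h x * c.map γ := by
  ext i j
  simp only [gram, Matrix.of_apply, map_sum, LinearMap.map_smulₛₗ, LinearMap.sum_apply,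
    LinearMap.smul_apply, Matrix.mul_apply, Matrix.conjTranspose_apply, Matrix.map_apply,
    smul_eq_mul, RingHom.comp_apply, Finset.sum_mul, Finset.mul_sum, starRingEnd_apply]
  refine Finset.sum_congr rfl fun a _ => Finset.sum_congr rfl fun b _ => by ring

theorem posDef_gram_of_basis (h : E →ₛₗ[(starRingEnd ℂ).comp γ] E →ₛₗ[γ] ℂ) {ι κ : Type*}
    [Fintype ι] [Fintype κ] (b : Module.Basis ι K E) (hb : (gram h b).PosDef)
    (x : κ → E) (hx : LinearIndependent K x) : (gram h x).PosDef := by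
  classical
  set c : Matrix ι κ K := b.toMatrix x with hc
  have hxc : x = fun j => ∑ i, c i j • b i := by
    funext j
    exact (b.sum_toMatrix_smul_self x j).symm
  have hinj : Function.Injective (Matrix.mulVecLin c) := by
    rw [← LinearMap.ker_eq_bot, LinearMap.ker_eq_bot']
    intro z hz
    have h0 : ∑ j, z j • x j = 0 := by
      rw [hxc]
      simp_rw [Finset.smul_sum]
      rw [Finset.sum_comm]
      refine Finset.sum_eq_zero fun i _ => ?_
      have := congrFun hz i
      simp only [Matrix.mulVecLin_apply, Matrix.mulVec, dotProduct, Pi.zero_apply] at this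
      simp_rw [smul_smul, ← Finset.sum_smul]
      rw [show (∑ j, z j * c i j) = ∑ j, c i j * z j from
        Finset.sum_congr rfl fun j _ => mul_comm _ _, this, zero_smul]
    funext j
    exact Fintype.linearIndependent_iff.mp hx z h0 j
  obtain ⟨g, hg⟩ := LinearMap.exists_leftInverse_of_injective _ (LinearMap.ker_eq_bot.mpr hinj)
  have hd : LinearMap.toMatrix' g * c = 1 := by
    have := congrArg LinearMap.toMatrix' hg
    rw [LinearMap.toMatrix'_comp, LinearMap.toMatrix'_id] at this
    simpa [← Matrix.toLin'_apply', LinearMap.toMatrix'_toLin'] using this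
  have hdγ : (LinearMap.toMatrix' g).map γ * c.map γ = 1 := by
    rw [← Matrix.map_mul, hd]; simp
  rw [hxc, gram_change]
  refine hb.conjTranspose_mul_mul_same ?_
  intro z z' hz
  have := congrArg (fun y => Matrix.mulVec ((LinearMap.toMatrix' g).map γ) y) hz
  simpa [Matrix.mulVec_mulVec, hdγ] using this

/-- The form on the dual space attached to a Hermitian form `h`: if `G` is the Gram matrix of `h`
in a basis `b`, its matrix in the dual basis is the transpose of `G⁻¹`. -/
noncomputable def dualForm (h : E →ₛₗ[(starRingEnd ℂ).comp γ] E →ₛₗ[γ] ℂ) {ι : Type*} [Fintype ι]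
    [DecidableEq ι] (b : Module.Basis ι K E) :
    Module.Dual K E →ₛₗ[(starRingEnd ℂ).comp γ] Module.Dual K E →ₛₗ[γ] ℂ :=
  LinearMap.mk₂'ₛₗ _ _
    (fun φ ψ => ∑ i, ∑ j, conj (γ (φ (b j))) * (gram h b)⁻¹ i j * γ (ψ (b i)))
    (fun φ φ' ψ => by
      simp only [LinearMap.add_apply, map_add, add_mul, Finset.sum_add_distrib])
    (fun c φ ψ => by
      simp only [LinearMap.smul_apply, map_mul, smul_eq_mul, Finset.mul_sum, mul_assoc,
        RingHom.comp_apply])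
    (fun φ ψ ψ' => by
      simp only [LinearMap.add_apply, map_add, mul_add, Finset.sum_add_distrib])
    (fun c φ ψ => by
      simp only [LinearMap.smul_apply, map_mul, smul_eq_mul, Finset.mul_sum]
      refine Finset.sum_congr rfl fun i _ => Finset.sum_congr rfl fun j _ => by ring)

theorem dualForm_apply (h : E →ₛₗ[(starRingEnd ℂ).comp γ] E →ₛₗ[γ] ℂ) {ι : Type*} [Fintype ι]
    [DecidableEq ι] (b : Module.Basis ι K E) (φ ψ : Module.Dual K E) :
    dualForm h b φ ψ =
      ∑ i, ∑ j, conj (γ (φ (b j))) * (gram h b)⁻¹ i j * γ (ψ (b i)) := rfl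

theorem gram_dualForm (h : E →ₛₗ[(starRingEnd ℂ).comp γ] E →ₛₗ[γ] ℂ) {ι : Type*} [Fintype ι]
    [DecidableEq ι] (b : Module.Basis ι K E) :
    gram (dualForm h b) b.dualBasis = ((gram h b)⁻¹).transpose := by
  ext k l
  simp [gram, dualForm_apply, Finsupp.single_apply,
    apply_ite γ, apply_ite (starRingEnd ℂ)]

/-- The quadratic form of `dualForm` is the square of the operator norm: it is the largest value of
`|φ(z)|² / h(z, z)` for nonzero `z = ∑ z_i b_i` in the extension of scalars of `E` to `ℂ`. -/
theorem isGreatest_dualForm (h : E →ₛₗ[(starRingEnd ℂ).comp γ] E →ₛₗ[γ] ℂ) {ι : Type*}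
    [Fintype ι] [DecidableEq ι]
    [Nonempty ι] (b : Module.Basis ι K E) (hb : (gram h b).PosDef) (φ : Module.Dual K E) :
    IsGreatest {r : ℝ | ∃ z : ι → ℂ, z ≠ 0 ∧
      r = ‖∑ i, z i * γ (φ (b i))‖ ^ 2 / (star z ⬝ᵥ (gram h b).mulVec z).re}
      (dualForm h b φ φ).re := by
  set G := gram h b with hG
  set f : ι → ℂ := fun i => γ (φ (b i)) with hf
  set z₀ : ι → ℂ := G⁻¹.mulVec (star f) with hz₀
  have hu := (Matrix.isUnit_iff_isUnit_det _).mp hb.isUnit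
  have hGu : G.mulVec z₀ = star f := by
    rw [hz₀, Matrix.mulVec_mulVec, Matrix.mul_nonsing_inv _ hu, Matrix.one_mulVec]
  have hpair : ∀ z : ι → ℂ, star z₀ ⬝ᵥ G.mulVec z = ∑ i, z i * γ (φ (b i)) := by
    intro z
    have h1 : Matrix.vecMul (star z₀) G = f := by
      have := Matrix.star_mulVec G z₀
      rw [hGu, star_star, hb.isHermitian.eq] at this
      exact this.symm
    rw [Matrix.dotProduct_mulVec, h1, dotProduct_comm]
    rfl
  have hD : dualForm h b φ φ = star z₀ ⬝ᵥ G.mulVec z₀ := by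
    rw [hpair, dualForm_apply]
    simp only [hz₀, Matrix.mulVec, dotProduct, Finset.sum_mul, ← hG, hf, Pi.star_apply]
    refine Finset.sum_congr rfl fun i _ => Finset.sum_congr rfl fun j _ => ?_
    rw [starRingEnd_apply]; ring
  have hDre : 0 ≤ (star z₀ ⬝ᵥ G.mulVec z₀).re := hb.posSemidef.re_dotProduct_nonneg z₀
  have hDim : star z₀ ⬝ᵥ G.mulVec z₀ = ((star z₀ ⬝ᵥ G.mulVec z₀).re : ℂ) :=
    (Complex.eq_re_of_ofReal_le (hb.posSemidef.dotProduct_mulVec_nonneg z₀))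
  constructor
  · by_cases hφ : z₀ = 0
    · refine ⟨1, one_ne_zero, ?_⟩
      rw [← hpair, hD, hφ]
      simp
    · refine ⟨z₀, hφ, ?_⟩
      have hpos : 0 < (star z₀ ⬝ᵥ G.mulVec z₀).re := hb.re_dotProduct_pos hφ
      rw [← hpair, hD, hDim, Complex.norm_real, Complex.ofReal_re, Real.norm_eq_abs, sq_abs]
      field_simp
  · rintro _ ⟨z, hz, rfl⟩
    have hpos : 0 < (star z ⬝ᵥ G.mulVec z).re := hb.re_dotProduct_pos hz
    rw [div_le_iff₀ hpos, ← hpair, hD]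
    let _ := Matrix.toSeminormedAddCommGroup G hb.posSemidef
    let _ := Matrix.toInnerProductSpace G hb.posSemidef
    have key := inner_mul_inner_self_le (𝕜 := ℂ) z₀ z
    have hi : ∀ x y : ι → ℂ, inner ℂ x y = star x ⬝ᵥ G.mulVec y := fun x y =>
      dotProduct_comm _ _
    rw [norm_inner_symm z z₀, ← sq, hi, hi, hi] at key
    exact key

variable {F : Type*} [AddCommGroup F] [Module K F]

/-- The tensor product of two sesquilinear forms, characterised by
`(x ⊗ y, x' ⊗ y') ↦ h x x' * k y y'`. -/
noncomputable def tensorForm (h : E →ₛₗ[(starRingEnd ℂ).comp γ] E →ₛₗ[γ] ℂ)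
    (k : F →ₛₗ[(starRingEnd ℂ).comp γ] F →ₛₗ[γ] ℂ) :
    (E ⊗[K] F) →ₛₗ[(starRingEnd ℂ).comp γ] (E ⊗[K] F) →ₛₗ[γ] ℂ :=
  TensorProduct.lift <| LinearMap.mk₂'ₛₗ _ _
    (fun x y => TensorProduct.lift <| LinearMap.mk₂'ₛₗ _ _ (fun x' y' => h x x' * k y y')
      (fun _ _ _ => by simp only [map_add, add_mul])
      (fun _ _ _ => by simp only [LinearMap.map_smulₛₗ, smul_eq_mul, mul_assoc])
      (fun _ _ _ => by simp only [map_add, mul_add])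
      (fun _ _ _ => by simp only [LinearMap.map_smulₛₗ, smul_eq_mul]; ring))
    (fun _ _ _ => by
      ext
      simp [add_mul])
    (fun _ _ _ => by
      ext
      simp [mul_assoc])
    (fun _ _ _ => by
      ext
      simp [mul_add])
    (fun _ _ _ => by
      ext
      simp [mul_left_comm])

@[simp]
theorem tensorForm_tmul (h : E →ₛₗ[(starRingEnd ℂ).comp γ] E →ₛₗ[γ] ℂ)
    (k : F →ₛₗ[(starRingEnd ℂ).comp γ] F →ₛₗ[γ] ℂ) (x x' : E) (y y' : F) :
    tensorForm h k (x ⊗ₜ y) (x' ⊗ₜ y') = h x x' * k y y' := rfl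

open scoped Kronecker in
theorem gram_tensorForm (h : E →ₛₗ[(starRingEnd ℂ).comp γ] E →ₛₗ[γ] ℂ)
    (k : F →ₛₗ[(starRingEnd ℂ).comp γ] F →ₛₗ[γ] ℂ) {ι κ : Type*} (b : Module.Basis ι K E)
    (c : Module.Basis κ K F) :
    gram (tensorForm h k) (b.tensorProduct c) = gram h b ⊗ₖ gram k c := by
  ext ⟨i, j⟩ ⟨i', j'⟩
  simp [gram, Module.Basis.tensorProduct_apply]

end Helpers

end RigidAdelicSpace

open scoped NumberField ComplexOrder in
/-- A rigid adelic space over a number field `K`, given as a Hermitian vector bundle over the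
spectrum of the ring of integers: a finite dimensional `K`-vector space `E` with an `𝓞 K`-lattice
(finitely generated, spanning `E` over `K`) and, for every embedding `γ : K → ℂ`, a Hermitian form
`h_γ` on `E ⊗_γ ℂ`.

A sesquilinear form on `E ⊗_γ ℂ` is the same thing as a biadditive map `E × E → ℂ`, `γ`-antilinear
in the first and `γ`-linear in the second variable, and this is how `h_γ` is recorded.  It is
positive definite on `E ⊗_γ ℂ` if and only if the Gram matrix of every `K`-linearly independent
family in `E` is (positivity on nonzero elements of `E` alone would be weaker).

`herm_conjugate` is the invariance under complex conjugation: for a complex place the two forms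
attached to the two conjugate embeddings determine each other, and for a real place it
says that `h_γ` is real valued on `E`. -/
structure RigidAdelicSpace (K : Type u) [Field K] [NumberField K] where
  /-- the underlying vector space -/
  carrier : Type v
  [addCommGroup : AddCommGroup carrier]
  [module : Module K carrier]
  [finite : FiniteDimensional K carrier]
  [intModule : Module (𝓞 K) carrier]
  [tower : IsScalarTower (𝓞 K) K carrier]
  /-- the lattice giving the structure at the finite places -/
  lattice : Submodule (𝓞 K) carrier
  isLattice : Submodule.IsLattice K lattice
  /-- the Hermitian forms at the infinite places -/
  herm : (γ : K →+* ℂ) → (carrier →ₛₗ[(starRingEnd ℂ).comp γ] carrier →ₛₗ[γ] ℂ)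
  herm_symm : ∀ γ x y, herm γ y x = (starRingEnd ℂ) (herm γ x y)
  herm_conjugate : ∀ γ x y,
    herm (NumberField.ComplexEmbedding.conjugate γ) x y = (starRingEnd ℂ) (herm γ x y)
  herm_posDef : ∀ γ (n : ℕ) (x : Fin n → carrier), LinearIndependent K x →
    (RigidAdelicSpace.gram (herm γ) x).PosDef

namespace RigidAdelicSpace

open scoped NumberField TensorProduct nonZeroDivisors ComplexConjugate ComplexOrder
open NumberField IsDedekindDomain

attribute [instance] addCommGroup module finite intModule tower isLattice

variable {K : Type u} [Field K] [NumberField K]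

theorem gram_conjugate (A : RigidAdelicSpace K) (γ : K →+* ℂ) {ι : Type*} (x : ι → A.carrier) :
    gram (A.herm (ComplexEmbedding.conjugate γ)) x = (gram (A.herm γ) x).map (starRingEnd ℂ) := by
  ext i j
  simp [gram, A.herm_conjugate]

theorem gram_posDef (A : RigidAdelicSpace K) (γ : K →+* ℂ) {ι : Type*} [Fintype ι]
    (x : ι → A.carrier) (hx : LinearIndependent K x) : (gram (A.herm γ) x).PosDef :=
  posDef_gram_of_basis (A.herm γ) (Module.finBasis K A.carrier)
    (A.herm_posDef γ _ _ (Module.finBasis K A.carrier).linearIndependent) x hx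

/-! ### Subspaces, duals, tensor products, conjugates -/

/-- A subspace `W` of a rigid adelic space, with the lattice `L ∩ W` and the restricted forms. -/
noncomputable def sub (A : RigidAdelicSpace.{u, v} K) (W : Submodule K A.carrier) :
    RigidAdelicSpace.{u, v} K where
  carrier := W
  lattice := A.lattice.comap (W.subtype.restrictScalars (𝓞 K))
  isLattice := by
    constructor
    · have : IsNoetherian (𝓞 K) A.lattice := inferInstance
      have h1 : (A.lattice.comap (W.subtype.restrictScalars (𝓞 K))).map
          (W.subtype.restrictScalars (𝓞 K)) ≤ A.lattice := Submodule.map_comap_le _ _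
      have h2 : ((A.lattice.comap (W.subtype.restrictScalars (𝓞 K))).map
          (W.subtype.restrictScalars (𝓞 K))).FG := by
        have := isNoetherian_of_le h1
        exact Module.Finite.iff_fg.mp inferInstance
      exact Submodule.fg_of_fg_map_injective (W.subtype.restrictScalars (𝓞 K))
        W.injective_subtype h2
    · rw [eq_top_iff]
      rintro x -
      obtain ⟨a, ha, hax⟩ := exists_smul_mem A.lattice Submodule.IsLattice.span_eq_top
        (x : A.carrier)
      have ha' : (algebraMap (𝓞 K) K a) ≠ 0 := by simpa using ha
      have : x = (algebraMap (𝓞 K) K a)⁻¹ • (a • x) := by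
        rw [← algebraMap_smul K a x, inv_smul_smul₀ ha']
      rw [this]
      exact Submodule.smul_mem _ _ (Submodule.subset_span hax)
  herm γ := (A.herm γ).domRestrict₁₂ W W
  herm_symm γ x y := A.herm_symm γ x y
  herm_conjugate γ x y := A.herm_conjugate γ x y
  herm_posDef γ n x hx :=
    A.herm_posDef γ n (fun i => (x i : A.carrier)) (hx.map' W.subtype (Submodule.ker_subtype W))

/-- The dual lattice `Hom(L, 𝓞 K)`, inside `Hom(E, K)`. -/
def dualLattice (A : RigidAdelicSpace.{u, v} K) : Submodule (𝓞 K) (Module.Dual K A.carrier) where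
  carrier := {φ | ∀ x ∈ A.lattice, ∃ a : 𝓞 K, φ x = algebraMap (𝓞 K) K a}
  zero_mem' _ _ := ⟨0, by simp⟩
  add_mem' {φ ψ} hφ hψ x hx := by
    obtain ⟨a, ha⟩ := hφ x hx
    obtain ⟨b, hb⟩ := hψ x hx
    exact ⟨a + b, by simp [ha, hb]⟩
  smul_mem' c φ hφ x hx := by
    obtain ⟨a, ha⟩ := hφ x hx
    exact ⟨c * a, by rw [LinearMap.smul_apply, ha, map_mul, Algebra.smul_def]⟩

theorem isLattice_dualLattice (A : RigidAdelicSpace.{u, v} K) :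
    Submodule.IsLattice K A.dualLattice := by
  classical
  constructor
  · obtain ⟨s, hs⟩ := (Submodule.IsLattice.fg : A.lattice.FG)
    let ev : Module.Dual K A.carrier →ₗ[𝓞 K] (s → K) :=
      { toFun := fun φ i => φ i
        map_add' := fun _ _ => rfl
        map_smul' := fun _ _ => rfl }
    have hev : Function.Injective ev := by
      intro φ ψ h
      have hsp : Submodule.span K (s : Set A.carrier) = ⊤ := by
        rw [← Submodule.span_span_of_tower (𝓞 K), hs]
        exact Submodule.IsLattice.span_eq_top
      exact LinearMap.ext_on hsp fun x hx => congrFun h ⟨x, hx⟩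
    refine Submodule.fg_of_fg_map_injective ev hev ?_
    let incl : (s → 𝓞 K) →ₗ[𝓞 K] (s → K) := (Algebra.linearMap (𝓞 K) K).compLeft s
    have hle : A.dualLattice.map ev ≤ LinearMap.range incl := by
      rintro _ ⟨φ, hφ, rfl⟩
      choose a ha using fun i : s => hφ i (hs ▸ Submodule.subset_span i.2)
      exact ⟨a, funext fun i => (ha i).symm⟩
    have hN : IsNoetherian (𝓞 K) (LinearMap.range incl) := inferInstance
    have := isNoetherian_of_le hle
    exact Module.Finite.iff_fg.mp inferInstance
  · rw [eq_top_iff]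
    rintro φ -
    obtain ⟨d, hd, hφ⟩ := exists_denom A.lattice Submodule.IsLattice.fg φ
    have hd' : (algebraMap (𝓞 K) K d) ≠ 0 := by simpa using hd
    have : φ = (algebraMap (𝓞 K) K d)⁻¹ • (d • φ) := by
      rw [← algebraMap_smul K d φ, inv_smul_smul₀ hd']
    rw [this]
    refine Submodule.smul_mem _ _ (Submodule.subset_span fun x hx => ?_)
    obtain ⟨a, ha⟩ := hφ x hx
    exact ⟨a, by rw [← ha, LinearMap.smul_apply, LinearMap.map_smul_of_tower]⟩

/-- The dual of a rigid adelic space: the dual space with the dual lattice and the dual Hermitian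
forms (whose quadratic forms are the squared operator norms, see `isGreatest_dualForm`). -/
noncomputable def dual (A : RigidAdelicSpace.{u, v} K) : RigidAdelicSpace.{u, max u v} K where
  carrier := Module.Dual K A.carrier
  lattice := A.dualLattice
  isLattice := A.isLattice_dualLattice
  herm γ := dualForm (A.herm γ) (Module.finBasis K A.carrier)
  herm_symm γ φ ψ := by
    have hG := (A.herm_posDef γ _ _ (Module.finBasis K A.carrier).linearIndependent).inv.isHermitian
    simp only [dualForm_apply, map_sum, map_mul, Complex.conj_conj]
    rw [Finset.sum_comm]
    refine Finset.sum_congr rfl fun i _ => Finset.sum_congr rfl fun j _ => ?_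
    rw [← hG.apply i j]
    simp only [starRingEnd_apply, star_star]
    ring
  herm_conjugate γ φ ψ := by
    have : (gram (A.herm (ComplexEmbedding.conjugate γ)) (Module.finBasis K A.carrier))⁻¹ =
        ((gram (A.herm γ) (Module.finBasis K A.carrier))⁻¹).map (starRingEnd ℂ) := by
      have hu := (A.herm_posDef γ _ _ (Module.finBasis K A.carrier).linearIndependent).isUnit
      rw [gram_conjugate]
      refine Matrix.inv_eq_left_inv ?_
      rw [← Matrix.map_mul, Matrix.nonsing_inv_mul _ ((Matrix.isUnit_iff_isUnit_det _).mp hu)]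
      simp
    simp only [dualForm_apply, map_sum, map_mul, this, Matrix.map_apply,
      ComplexEmbedding.conjugate_coe_eq]
  herm_posDef γ n x hx := by
    refine posDef_gram_of_basis _ (Module.finBasis K A.carrier).dualBasis ?_ x hx
    rw [gram_dualForm]
    exact (A.herm_posDef γ _ _ (Module.finBasis K A.carrier).linearIndependent).inv.transpose

/-- The tensor product of two rigid adelic spaces: the lattice is the image of `L ⊗ M`, the forms
are the tensor products of the forms. -/
noncomputable def tensor (A : RigidAdelicSpace.{u, v} K) (B : RigidAdelicSpace.{u, w} K) :
    RigidAdelicSpace.{u, max v w} K where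
  carrier := A.carrier ⊗[K] B.carrier
  lattice := Submodule.span (𝓞 K) {z | ∃ x ∈ A.lattice, ∃ y ∈ B.lattice, x ⊗ₜ[K] y = z}
  isLattice := by
    constructor
    · have h := Submodule.FG.map₂
        ((TensorProduct.mk K A.carrier B.carrier).restrictScalars₁₂ (𝓞 K) (𝓞 K))
        (Submodule.IsLattice.fg : A.lattice.FG) (Submodule.IsLattice.fg : B.lattice.FG)
      rwa [Submodule.map₂_eq_span_image2] at h
    · rw [Submodule.span_span_of_tower, eq_top_iff, ← TensorProduct.span_tmul_eq_top,
        Submodule.span_le]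
      rintro _ ⟨x, y, rfl⟩
      obtain ⟨a, ha, hax⟩ := exists_smul_mem A.lattice Submodule.IsLattice.span_eq_top x
      obtain ⟨b, hb, hby⟩ := exists_smul_mem B.lattice Submodule.IsLattice.span_eq_top y
      have ha' : (algebraMap (𝓞 K) K a) ≠ 0 := by simpa using ha
      have hb' : (algebraMap (𝓞 K) K b) ≠ 0 := by simpa using hb
      have : x ⊗ₜ[K] y = ((algebraMap (𝓞 K) K a)⁻¹ * (algebraMap (𝓞 K) K b)⁻¹) •
          ((a • x) ⊗ₜ[K] (b • y)) := by
        rw [← algebraMap_smul K a x, ← algebraMap_smul K b y, TensorProduct.smul_tmul_smul,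
          smul_smul]
        rw [show (algebraMap (𝓞 K) K a)⁻¹ * (algebraMap (𝓞 K) K b)⁻¹ *
          (algebraMap (𝓞 K) K a * algebraMap (𝓞 K) K b) = 1 by field_simp, one_smul]
      rw [this]
      exact Submodule.smul_mem _ _ (Submodule.subset_span ⟨_, hax, _, hby, rfl⟩)
  herm γ := tensorForm (A.herm γ) (B.herm γ)
  herm_symm γ x y := by
    induction x using TensorProduct.induction_on with
    | zero => simp
    | add x x' hx hx' => simp only [map_add, LinearMap.add_apply, hx, hx']
    | tmul x x' =>
      induction y using TensorProduct.induction_on with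
      | zero => simp
      | add y y' hy hy' => simp only [map_add, LinearMap.add_apply, hy, hy']
      | tmul y y' =>
        simp only [tensorForm_tmul, map_mul]
        rw [A.herm_symm γ x y, B.herm_symm γ x' y']
  herm_conjugate γ x y := by
    induction x using TensorProduct.induction_on with
    | zero => simp
    | add x x' hx hx' => simp only [map_add, LinearMap.add_apply, hx, hx']
    | tmul x x' =>
      induction y using TensorProduct.induction_on with
      | zero => simp
      | add y y' hy hy' => simp only [map_add, LinearMap.add_apply, hy, hy']
      | tmul y y' =>
        simp only [tensorForm_tmul, map_mul, A.herm_conjugate γ x y, B.herm_conjugate γ x' y']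
  herm_posDef γ n x hx := by
    refine posDef_gram_of_basis _
      ((Module.finBasis K A.carrier).tensorProduct (Module.finBasis K B.carrier)) ?_ x hx
    rw [gram_tensorForm]
    exact (A.herm_posDef γ _ _ (Module.finBasis K A.carrier).linearIndependent).kronecker
      (B.herm_posDef γ _ _ (Module.finBasis K B.carrier).linearIndependent)

/-- The abelian group underlying the conjugate of a rigid adelic space. -/
def ConjCarrier (A : RigidAdelicSpace.{u, v} K) : Type v := A.carrier

instance (A : RigidAdelicSpace.{u, v} K) : AddCommGroup A.ConjCarrier :=
  inferInstanceAs (AddCommGroup A.carrier)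

/-- The identity map from a rigid adelic space to its conjugate. -/
def toConj (A : RigidAdelicSpace.{u, v} K) : A.carrier ≃+ A.ConjCarrier := AddEquiv.refl A.carrier

section CM

variable [IsCMField K]

/-- The twisted external law `a ⋆ x = conj a • x`. -/
noncomputable instance (A : RigidAdelicSpace.{u, v} K) : Module K A.ConjCarrier :=
  Module.compHom A.carrier ((IsCMField.complexConj K).toRingEquiv : K →+* K)

noncomputable instance (A : RigidAdelicSpace.{u, v} K) : Module (𝓞 K) A.ConjCarrier :=
  Module.compHom A.carrier ((IsCMField.ringOfIntegersComplexConj K).toRingEquiv : 𝓞 K →+* 𝓞 K)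

theorem conj_smul (A : RigidAdelicSpace.{u, v} K) (a : K) (x : A.ConjCarrier) :
    a • x = A.toConj (IsCMField.complexConj K a • A.toConj.symm x) := rfl

theorem conj_int_smul (A : RigidAdelicSpace.{u, v} K) (a : 𝓞 K) (x : A.ConjCarrier) :
    a • x = A.toConj (IsCMField.ringOfIntegersComplexConj K a • A.toConj.symm x) := rfl

instance (A : RigidAdelicSpace.{u, v} K) : IsScalarTower (𝓞 K) K A.ConjCarrier := by
  refine ⟨fun a k x => ?_⟩
  rw [conj_smul, conj_int_smul, conj_smul, AddEquiv.symm_apply_apply, Algebra.smul_def, map_mul,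
    mul_smul]
  congr 1
  exact algebraMap_smul K (IsCMField.ringOfIntegersComplexConj K a) _

instance (A : RigidAdelicSpace.{u, v} K) : FiniteDimensional K A.ConjCarrier := by
  let f : A.carrier →ₛₗ[((IsCMField.complexConj K).toRingEquiv : K →+* K)] A.ConjCarrier :=
    { toFun := A.toConj
      map_add' := fun _ _ => map_add _ _ _
      map_smul' := fun c x => by
        rw [conj_smul]
        simp }
  exact Module.Finite.of_surjective f A.toConj.surjective

/-- The conjugate of a rigid adelic space over a CM field: the vector space with the twisted
external law, the same lattice, and at the embedding `γ` the form of the original space at the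
conjugate embedding (the extension of scalars along `γ` of the conjugate space is the extension of
scalars along the conjugate of `γ` of the original space). -/
noncomputable def conjugate (A : RigidAdelicSpace.{u, v} K) : RigidAdelicSpace.{u, v} K where
  carrier := A.ConjCarrier
  lattice :=
    { carrier := {x | A.toConj.symm x ∈ A.lattice}
      zero_mem' := A.lattice.zero_mem
      add_mem' := fun hx hy => A.lattice.add_mem hx hy
      smul_mem' := fun a _ hx =>
        A.lattice.smul_mem (IsCMField.ringOfIntegersComplexConj K a) hx }
  isLattice := by
    constructor
    · obtain ⟨s, hs⟩ := (Submodule.IsLattice.fg : A.lattice.FG)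
      refine ⟨s.map A.toConj.toEquiv.toEmbedding, le_antisymm (Submodule.span_le.mpr ?_) ?_⟩
      · intro x hx
        obtain ⟨y, hy, rfl⟩ := Finset.mem_map.mp hx
        exact (hs ▸ Submodule.subset_span hy : y ∈ A.lattice)
      · rintro x hx
        have hx' : A.toConj.symm x ∈ Submodule.span (𝓞 K) (s : Set A.carrier) := hs ▸ hx
        rw [← A.toConj.apply_symm_apply x]
        generalize A.toConj.symm x = z at hx'
        induction hx' using Submodule.span_induction with
        | mem y hy => exact Submodule.subset_span (Finset.mem_map_of_mem _ hy)
        | zero => simp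
        | add y z _ _ hy hz => rw [map_add]; exact Submodule.add_mem _ hy hz
        | smul a y _ hy =>
          have := Submodule.smul_mem _ (IsCMField.ringOfIntegersComplexConj K a) hy
          rw [conj_int_smul] at this
          have h2 : IsCMField.ringOfIntegersComplexConj K
              (IsCMField.ringOfIntegersComplexConj K a) = a := by ext; simp
          rwa [h2, AddEquiv.symm_apply_apply] at this
    · rw [eq_top_iff]
      rintro x -
      obtain ⟨a, ha, hax⟩ := exists_smul_mem A.lattice Submodule.IsLattice.span_eq_top
        (A.toConj.symm x)
      have ha' : (algebraMap (𝓞 K) K a) ≠ 0 := by simpa using ha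
      have : x = (IsCMField.complexConj K (algebraMap (𝓞 K) K a))⁻¹ •
          A.toConj (a • A.toConj.symm x) := by
        rw [conj_smul, AddEquiv.symm_apply_apply, map_inv₀, IsCMField.complexConj_apply_apply,
          ← algebraMap_smul K a, inv_smul_smul₀ ha', AddEquiv.apply_symm_apply]
      rw [this]
      exact Submodule.smul_mem _ _ (Submodule.subset_span hax)
  herm γ := LinearMap.mk₂'ₛₗ _ _
    (fun x y => A.herm (ComplexEmbedding.conjugate γ) (A.toConj.symm x) (A.toConj.symm y))
    (fun _ _ _ => by simp only [map_add, LinearMap.add_apply])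
    (fun a x y => by
      simp [conj_smul])
    (fun _ _ _ => by simp only [map_add])
    (fun a x y => by
      simp [conj_smul])
  herm_symm γ x y := A.herm_symm _ _ _
  herm_conjugate γ x y := A.herm_conjugate _ _ _
  herm_posDef γ n x hx := by
    refine A.herm_posDef (ComplexEmbedding.conjugate γ) n (fun i => A.toConj.symm (x i)) ?_
    rw [Fintype.linearIndependent_iff] at hx ⊢
    intro g hg i
    have := hx (fun i => IsCMField.complexConj K (g i)) (by
      simpa [conj_smul] using congrArg A.toConj hg) i
    simpa using this

end CM

/-! ### Local norms, isometries and similarities -/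

/-- The norm at an infinite place, on vectors of `E`. -/
noncomputable def infNorm (A : RigidAdelicSpace.{u, v} K) (w : InfinitePlace K) (x : A.carrier) :
    ℝ :=
  Real.sqrt (A.herm w.embedding x x).re

/-- The norm at a finite place `p`, on vectors of `E`: the infimum of the normalised absolute values
`|α|_p` of the scalars `α` such that `x ∈ α L_p`, where `L_p` is the localisation of the lattice `L`
at `p`; the latter means that `s x ∈ α L` for some integer `s` outside `p`. -/
noncomputable def finNorm (A : RigidAdelicSpace.{u, v} K) (p : HeightOneSpectrum (𝓞 K))
    (x : A.carrier) : ℝ :=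
  sInf {r : ℝ | ∃ α : K, (∃ s : 𝓞 K, s ∉ p.asIdeal ∧ ∃ y ∈ A.lattice, s • x = α • y) ∧
    r = HeightOneSpectrum.adicAbv K p α}

/-- A `K`-linear map is a similarity if it multiplies the local norm at every place by a positive
constant, equal to `1` at almost all places.  (As `E` is dense in its completions it is
enough to consider the vectors of `E`.) -/
def IsSimilarity {A : RigidAdelicSpace.{u, v} K} {B : RigidAdelicSpace.{u, w} K}
    (σ : A.carrier →ₗ[K] B.carrier) : Prop :=
  (∀ w : InfinitePlace K, ∃ c : ℝ, 0 < c ∧ ∀ x, B.infNorm w (σ x) = c * A.infNorm w x) ∧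
  ∃ c : HeightOneSpectrum (𝓞 K) → ℝ, (∀ p, 0 < c p) ∧ {p | c p ≠ 1}.Finite ∧
    ∀ p x, B.finNorm p (σ x) = c p * A.finNorm p x

/-! ### Isodual spaces and their types -/

/-- The bilinear form `b_σ (x, y) = σ (x) (y)` of a map from a space to its dual. -/
noncomputable def form {A : RigidAdelicSpace.{u, v} K} (σ : A.carrier →ₗ[K] A.dual.carrier)
    (x y : A.carrier) : K :=
  let φ : Module.Dual K A.carrier := σ x
  φ y

/-- The sesquilinear form `b_σ (x, y) = σ (x) (y)` of a map from a space to its conjugate dual. -/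
noncomputable def conjForm [IsCMField K] {A : RigidAdelicSpace.{u, v} K}
    (σ : A.carrier →ₗ[K] A.dual.conjugate.carrier) (x y : A.carrier) : K :=
  let φ : Module.Dual K A.carrier := A.dual.toConj.symm (σ x)
  φ y

/-- Isodual: similar to its dual. -/
def IsIsodual (A : RigidAdelicSpace.{u, v} K) : Prop :=
  ∃ σ : A.carrier →ₗ[K] A.dual.carrier, IsSimilarity σ

/-- Orthogonal: isodual with symmetric `b_σ`. -/
def IsOrthogonal (A : RigidAdelicSpace.{u, v} K) : Prop :=
  ∃ σ : A.carrier →ₗ[K] A.dual.carrier, IsSimilarity σ ∧ ∀ x y, form σ y x = form σ x y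

/-- Symplectic: isodual with alternating `b_σ`. -/
def IsSymplectic (A : RigidAdelicSpace.{u, v} K) : Prop :=
  ∃ σ : A.carrier →ₗ[K] A.dual.carrier, IsSimilarity σ ∧ ∀ x, form σ x x = 0

/-- Unitary: similar to its conjugate dual, with Hermitian `b_σ`. -/
def IsUnitary [IsCMField K] (A : RigidAdelicSpace.{u, v} K) : Prop :=
  ∃ σ : A.carrier →ₗ[K] A.dual.conjugate.carrier, IsSimilarity σ ∧
    ∀ x y, conjForm σ y x = IsCMField.complexConj K (conjForm σ x y)

/-! ### Heights -/

/-- The determinant ideal of the lattice with respect to a basis `b` of `E`: the fractional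
ideal generated by the determinants in the basis `b` of families of vectors of the lattice.  If the
lattice is `⨁ 𝔞 i • b i` then this is `∏ 𝔞 i`. -/
noncomputable def detIdeal (A : RigidAdelicSpace.{u, v} K) {ι : Type*} [Fintype ι] [DecidableEq ι]
    (b : Module.Basis ι K A.carrier) : FractionalIdeal (𝓞 K)⁰ K :=
  ⟨Submodule.span (𝓞 K) {d : K | ∃ x : ι → A.carrier, (∀ i, x i ∈ A.lattice) ∧ b.det x = d}, by
    choose d hd hdx using fun i => exists_denom A.lattice Submodule.IsLattice.fg (b.coord i)
    refine ⟨∏ i, d i, mem_nonZeroDivisors_of_ne_zero (Finset.prod_ne_zero_iff.mpr fun i _ => hd i),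
      fun z hz => ?_⟩
    induction hz using Submodule.span_induction with
    | mem z hz =>
      obtain ⟨x, hx, rfl⟩ := hz
      choose a ha using fun i j => hdx i (x j) (hx j)
      refine ⟨(Matrix.of a).det, ?_⟩
      rw [Algebra.smul_def, map_prod, Module.Basis.det_apply, ← Matrix.det_mul_column,
        RingHom.map_det]
      congr 1
      ext i j
      rw [RingHom.mapMatrix_apply, Matrix.map_apply, Matrix.of_apply, Matrix.of_apply, ← ha,
        LinearMap.map_smul_of_tower, Algebra.smul_def, Module.Basis.toMatrix_apply,
        Module.Basis.coord_apply]
    | zero => exact ⟨0, by simp⟩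
    | add y z _ _ hy hz => rw [smul_add]; exact IsLocalization.isInteger_add hy hz
    | smul a z _ hz => rw [smul_comm]; exact IsLocalization.isInteger_smul hz⟩

/-- The height computed in a basis `b` of `E`. -/
noncomputable def heightIn (A : RigidAdelicSpace.{u, v} K) {ι : Type*} [Fintype ι] [DecidableEq ι]
    (b : Module.Basis ι K A.carrier) : ℝ :=
  (((FractionalIdeal.absNorm (A.detIdeal b) : ℚ) : ℝ) *
    ∏ w : InfinitePlace K, (gram (A.herm w.embedding) b).det.re ^ ((w.mult : ℝ) / 2)) ^
      (1 / (Module.finrank ℚ K : ℝ))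

/-- The (normalised) height, computed in any basis. -/
noncomputable def height (A : RigidAdelicSpace.{u, v} K) : ℝ :=
  A.heightIn (Module.finBasis K A.carrier)

theorem detIdeal_change (A : RigidAdelicSpace.{u, v} K) {ι κ : Type*} [Fintype ι] [DecidableEq ι]
    [Fintype κ] [DecidableEq κ] (b : Module.Basis ι K A.carrier) (c : Module.Basis κ K A.carrier)
    (e : κ ≃ ι) :
    A.detIdeal b = FractionalIdeal.spanSingleton (𝓞 K)⁰ (b.det (c.reindex e)) * A.detIdeal c := by
  have key : ∀ x : ι → A.carrier, b.det x = b.det (c.reindex e) * c.det (x ∘ e) := by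
    intro x
    have h2 := AlternatingMap.eq_smul_basis_det (c.reindex e) b.det
    have h3 := congrArg (fun f => f x) h2
    rw [show b.det x = _ from h3]
    rw [AlternatingMap.smul_apply, smul_eq_mul, Module.Basis.det_reindex]
  apply FractionalIdeal.coeToSubmodule_injective
  beta_reduce
  rw [FractionalIdeal.coe_mul, FractionalIdeal.coe_spanSingleton]
  change Submodule.span _ _ = _ * Submodule.span _ _
  rw [Submodule.span_mul_span]
  congr 1
  ext d
  rw [Set.singleton_mul]
  constructor
  · rintro ⟨x, hx, rfl⟩
    exact ⟨_, ⟨x ∘ e, fun i => hx _, rfl⟩, (key x).symm⟩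
  · rintro ⟨_, ⟨x, hx, rfl⟩, rfl⟩
    refine ⟨x ∘ e.symm, fun i => hx _, ?_⟩
    rw [key]
    congr 2
    funext i
    simp

/-- The height does not depend on the basis used to compute it. -/
theorem height_eq_heightIn (A : RigidAdelicSpace.{u, v} K) {ι : Type*} [Fintype ι] [DecidableEq ι]
    (b : Module.Basis ι K A.carrier) : A.height = A.heightIn b := by
  set c := Module.finBasis K A.carrier with hc
  let e : Fin (Module.finrank K A.carrier) ≃ ι := c.indexEquiv b
  set D := b.det (c.reindex e) with hD
  have hgram : ∀ w : InfinitePlace K, (gram (A.herm w.embedding) c).det.re =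
      w D ^ 2 * (gram (A.herm w.embedding) b).det.re := by
    intro w
    have h1 : (⇑(c.reindex e)) = fun j => ∑ i, b.toMatrix (c.reindex e) i j • b i := by
      funext j
      exact (b.sum_toMatrix_smul_self _ j).symm
    have h2 : gram (A.herm w.embedding) c =
        (gram (A.herm w.embedding) (c.reindex e)).submatrix e e := by
      ext i j
      simp [gram]
    rw [h2, Matrix.det_submatrix_equiv_self, h1, gram_change, Matrix.det_mul, Matrix.det_mul,
      Matrix.det_conjTranspose]
    have h3 : ((b.toMatrix (c.reindex e)).map w.embedding).det = w.embedding D := by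
      rw [hD, Module.Basis.det_apply, RingHom.map_det]; rfl
    rw [h3, mul_right_comm, ← InfinitePlace.norm_embedding_eq]
    rw [show star (w.embedding D) * w.embedding D = ((‖w.embedding D‖ ^ 2 : ℝ) : ℂ) by
      rw [← starRingEnd_apply, Complex.conj_mul']; push_cast; rfl]
    rw [Complex.re_ofReal_mul]
  rw [height, heightIn, heightIn, A.detIdeal_change b c e, map_mul,
    FractionalIdeal.absNorm_span_singleton]
  congr 1
  have hpos : ∀ w : InfinitePlace K, 0 ≤ (gram (A.herm w.embedding) b).det.re := fun w =>
    (Complex.le_def.mp (A.gram_posDef w.embedding b b.linearIndependent).det_pos.le).1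
  have : ∀ w : InfinitePlace K, (gram (A.herm w.embedding) c).det.re ^ ((w.mult : ℝ) / 2) =
      w D ^ w.mult * (gram (A.herm w.embedding) b).det.re ^ ((w.mult : ℝ) / 2) := by
    intro w
    rw [hgram, Real.mul_rpow (by positivity) (hpos w), ← Real.rpow_natCast, ← Real.rpow_mul
      (apply_nonneg w D), ← Real.rpow_natCast]
    congr 2
    push_cast; ring
  rw [Finset.prod_congr rfl fun w _ => this w]
  rw [Finset.prod_mul_distrib, InfinitePlace.prod_eq_abs_norm]
  push_cast
  ring

open scoped Pointwise in
/-- The height in terms of a pseudo-basis `L = ⨁ 𝔞 i • b i` of the lattice. -/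
theorem height_eq_of_pseudoBasis (A : RigidAdelicSpace.{u, v} K) {ι : Type*} [Fintype ι]
    [DecidableEq ι] (b : Module.Basis ι K A.carrier) (𝔞 : ι → FractionalIdeal (𝓞 K)⁰ K)
    (hL : ∀ x, x ∈ A.lattice ↔ ∀ i, b.repr x i ∈ 𝔞 i) :
    A.height = (((FractionalIdeal.absNorm (∏ i, 𝔞 i) : ℚ) : ℝ) *
      ∏ w : InfinitePlace K, (gram (A.herm w.embedding) b).det.re ^ ((w.mult : ℝ) / 2)) ^
        (1 / (Module.finrank ℚ K : ℝ)) := by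
  rw [A.height_eq_heightIn b, heightIn]
  suffices h : A.detIdeal b = ∏ i, 𝔞 i by rw [h]
  have hprod : ((∏ i, 𝔞 i : FractionalIdeal (𝓞 K)⁰ K) : Submodule (𝓞 K) K) =
      ∏ i, (𝔞 i : Submodule (𝓞 K) K) :=
    map_prod (FractionalIdeal.coeSubmoduleHom (𝓞 K)⁰ K) _ _
  have hspan : ∏ i, (𝔞 i : Submodule (𝓞 K) K) =
      Submodule.span (𝓞 K) (∏ i, ((𝔞 i : Submodule (𝓞 K) K) : Set K)) := by
    rw [← Submodule.prod_span]; simp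
  apply FractionalIdeal.coeToSubmodule_injective
  beta_reduce
  rw [hprod, hspan]
  apply le_antisymm
  · refine Submodule.span_le.mpr ?_
    rintro _ ⟨x, hx, rfl⟩
    rw [Module.Basis.det_apply, ← Matrix.det_transpose, Matrix.det_apply]
    refine Submodule.sum_mem _ fun σ _ => ?_
    rw [Units.smul_def]
    refine zsmul_mem (Submodule.subset_span ?_) _
    refine (Set.mem_fintype_prod _ _).mpr ⟨_, fun i => ?_, rfl⟩
    simpa [Module.Basis.toMatrix_apply] using (hL _).mp (hx _) _
  · rw [Submodule.span_le]
    intro z hz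
    obtain ⟨g, hg, rfl⟩ := (Set.mem_fintype_prod _ _).mp hz
    refine Submodule.subset_span ⟨fun i => g i • b i, fun i => (hL _).mpr fun j => ?_, ?_⟩
    · by_cases hij : i = j
      · subst hij; simpa using hg i
      · simp [hij, (𝔞 j).zero_mem]
    · have : b.toMatrix (fun i => g i • b i) = Matrix.diagonal g := by
        ext i j
        by_cases hij : i = j
        · subst hij; simp [Module.Basis.toMatrix_apply]
        · simp [Module.Basis.toMatrix_apply, hij]
      rw [Module.Basis.det_apply, this, Matrix.det_diagonal]

/-- The reduced height. -/
noncomputable def reducedHeight (A : RigidAdelicSpace.{u, v} K) : ℝ :=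
  A.height ^ (1 / (Module.finrank K A.carrier : ℝ))

/-- The minimal reduced height of the nonzero subspaces (used for nonzero spaces only). -/
noncomputable def minHeight (A : RigidAdelicSpace.{u, v} K) : ℝ :=
  ⨅ W : {W : Submodule K A.carrier // W ≠ ⊥}, (A.sub W.1).reducedHeight

end RigidAdelicSpace

/-!
Multiplicativity of minimal heights is inherited by orthogonal summands of smallest minimal height,
and every rigid adelic space `E` is such a summand of an orthogonal, of a symplectic and, over a CM
field, of a unitary space.

Let `P` be the sum of `E` and of its dual with all Hermitian forms multiplied by `t > 0`
(`directSum`). The map `(x, φ) ↦ ((y, ψ) ↦ φ y ± ψ x)` from `P` to its dual respects the lattices,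
because lattices over a Dedekind domain are reflexive, and it multiplies the norms at the infinite
places by `t ^ (-1 / 2)`, because the dual of the sum is the sum of the dual, and of the bidual with
forms multiplied by `1 / t`. So `P` is orthogonal and symplectic for every `t`
(`isOrthogonal_directSum_dual`, `isSymplectic_directSum_dual`), and replacing the dual by its
conjugate and `ψ x` by its complex conjugate makes it unitary
(`isUnitary_directSum_dual_conjugate`).

On the other hand the minimal height of an orthogonal sum is the smaller one of the minimal heights
of the summands, and scaling the forms of the second summand by `t` multiplies its minimal height by
`√t`. As this minimal height is positive (`minHeight_pos`), for large `t` that of `P` is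
`H_min(E)` (`OrthogonalSum.minHeight_eq`); the same holds after tensoring with `F`, and the two
equalities give the claim for `E` (`minHeight_tensor_of_directSum`).

All estimates of heights come from a single one, `IsContraction.height_mul_height_le`: if a linear
map `p` maps lattice to lattice and does not increase the norms at the infinite places, then
`H(W) ≥ H(W ∩ ker p) * H(p W)`. It rests on pseudo-bases adapted to the kernel
(`exists_isPseudoBasis_of_exact`) for the ideals and on a Schur complement
(`det_mul_det_le_det_fromBlocks`) for the Gram determinants.
-/

namespace RigidAdelicSpace

open scoped NumberField TensorProduct nonZeroDivisors ComplexConjugate ComplexOrder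
open NumberField IsDedekindDomain

/-! ### Determinants of positive matrices -/

section Matrices

open scoped Matrix

variable {m n : Type*} [Fintype m] [Fintype n] [DecidableEq m] [DecidableEq n]

theorem one_le_det_one_add {T : Matrix n n ℂ} (hT : T.PosSemidef) : 1 ≤ (1 + T).det := by
  -- evaluate the characteristic polynomial of `T` at `-1`
  have h1 : (1 + T).det = ∏ i, (1 + (hT.isHermitian.eigenvalues i : ℂ)) := by
    have h := congrArg (Polynomial.eval (-1 : ℂ)) hT.isHermitian.charpoly_eq
    rw [Matrix.eval_charpoly, Polynomial.eval_prod] at h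
    have h2 : Matrix.scalar n (-1 : ℂ) - T = -(1 + T) := by
      rw [map_neg, map_one]; abel
    rw [h2, Matrix.det_neg] at h
    have h3 : ∀ i, Polynomial.eval (-1 : ℂ)
        (Polynomial.X - Polynomial.C (hT.isHermitian.eigenvalues i : ℂ)) =
          (-1) * (1 + (hT.isHermitian.eigenvalues i : ℂ)) := by
      intro i; simp; ring
    simp only [Complex.coe_algebraMap] at h
    rw [Finset.prod_congr rfl fun i _ => h3 i, Finset.prod_mul_distrib, Finset.prod_const,
      Finset.card_univ] at h
    exact mul_left_cancel₀ (pow_ne_zero _ (by norm_num)) h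
  rw [h1]
  refine Finset.one_le_prod fun i => ?_
  have := hT.eigenvalues_nonneg i
  simpa using this

/-- The determinant is monotone for the Loewner order. -/
theorem det_le_det_add {S T : Matrix n n ℂ} (hS : S.PosDef) (hT : T.PosSemidef) :
    S.det ≤ (S + T).det := by
  obtain ⟨B, hB, rfl⟩ : ∃ B : Matrix n n ℂ, IsUnit B.det ∧ S = Bᴴ * B := by
    open scoped MatrixOrder in
    obtain ⟨B, hB⟩ := CStarAlgebra.nonneg_iff_eq_star_mul_self.mp hS.posSemidef.nonneg
    refine ⟨B, ?_, hB⟩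
    have := hS.det_pos.ne'
    rw [hB, Matrix.det_mul] at this
    exact isUnit_iff_ne_zero.mpr (right_ne_zero_of_mul this)
  have h1 : Bᴴ * B + T = Bᴴ * (1 + (B⁻¹)ᴴ * T * B⁻¹) * B := by
    have h2 : Bᴴ * (B⁻¹)ᴴ = 1 := by
      rw [← Matrix.conjTranspose_mul, Matrix.nonsing_inv_mul _ hB, Matrix.conjTranspose_one]
    rw [mul_add, add_mul, mul_one]
    congr 1
    rw [← mul_assoc, ← mul_assoc, h2, one_mul, mul_assoc, Matrix.nonsing_inv_mul _ hB, mul_one]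
  have h3 := one_le_det_one_add (hT.conjTranspose_mul_mul_same B⁻¹)
  have h4 := hS.posSemidef.det_nonneg
  rw [h1, Matrix.det_mul (Bᴴ * _) B, Matrix.det_mul Bᴴ (1 + _), mul_right_comm,
    ← Matrix.det_mul]
  exact le_mul_of_one_le_right h4 h3

/-- Fischer-type inequality: a positive matrix which dominates a positive definite matrix `S` in
the second block has determinant at least that of its first block times that of `S`. -/
theorem det_mul_det_le_det_fromBlocks {P : Matrix m m ℂ} {Q : Matrix m n ℂ} {Q' : Matrix n m ℂ}
    {R S : Matrix n n ℂ} (hP : P.PosDef) (hS : S.PosDef)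
    (h : (Matrix.fromBlocks P Q Q' (R - S)).PosSemidef) :
    P.det * S.det ≤ (Matrix.fromBlocks P Q Q' R).det := by
  have hQ : Q' = Qᴴ := by
    have := h.isHermitian
    rw [Matrix.isHermitian_fromBlocks_iff] at this
    exact this.2.1.symm
  subst hQ
  let _ := hP.isUnit.invertible
  have h1 := (hP.fromBlocks₁₁ Q (R - S)).mp h
  rw [Matrix.det_fromBlocks₁₁, Matrix.invOf_eq_nonsing_inv]
  refine mul_le_mul_of_nonneg_left ?_ hP.det_pos.le
  have h2 := det_le_det_add hS h1
  rwa [show S + (R - S - Qᴴ * P⁻¹ * Q) = R - Qᴴ * P⁻¹ * Q by abel] at h2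

end Matrices

/-! ### Pseudo-bases of lattices -/

section PseudoBasis

variable {K : Type u} [Field K] [NumberField K]

/-- Smaller nonzero fractional ideals have larger norms. -/
theorem absNorm_le_absNorm {I J : FractionalIdeal (𝓞 K)⁰ K} (hI : I ≠ 0) (hIJ : I ≤ J) :
    FractionalIdeal.absNorm J ≤ FractionalIdeal.absNorm I := by
  have hJ : J ≠ 0 := fun h => hI (le_antisymm (h ▸ hIJ) (FractionalIdeal.zero_le _))
  have h1 : I * J⁻¹ ≤ 1 := by
    rw [← mul_inv_cancel₀ hJ]
    exact mul_le_mul' hIJ le_rfl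
  obtain ⟨𝔠, h𝔠⟩ := FractionalIdeal.le_one_iff_exists_coeIdeal.mp h1
  have hI2 : I = J * (𝔠 : FractionalIdeal (𝓞 K)⁰ K) := by
    rw [h𝔠, mul_comm I, ← mul_assoc, mul_inv_cancel₀ hJ, one_mul]
  have h𝔠0 : 𝔠 ≠ 0 := by
    rintro rfl
    exact hI (by rw [hI2]; simp)
  rw [hI2, map_mul, FractionalIdeal.coeIdeal_absNorm]
  refine le_mul_of_one_le_right (FractionalIdeal.absNorm_nonneg J) ?_
  exact_mod_cast Nat.one_le_iff_ne_zero.mpr (by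
    rwa [Ne, Ideal.absNorm_eq_zero_iff])

variable {V : Type*} [AddCommGroup V] [Module K V] [Module (𝓞 K) V] [IsScalarTower (𝓞 K) K V]

/-- A pseudo-basis of a submodule `L` of a `K`-vector space: a basis `b` with nonzero fractional
ideals `𝔞 i` such that `L = ⨁ 𝔞 i • b i`. -/
structure IsPseudoBasis (L : Submodule (𝓞 K) V) {ι : Type*} (b : Module.Basis ι K V)
    (𝔞 : ι → FractionalIdeal (𝓞 K)⁰ K) : Prop where
  ne_zero : ∀ i, 𝔞 i ≠ 0
  mem_iff : ∀ x, x ∈ L ↔ ∀ i, b.repr x i ∈ 𝔞 i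

omit [NumberField K] [IsScalarTower (𝓞 K) K V] in
theorem IsPseudoBasis.smul_mem {L : Submodule (𝓞 K) V} {ι : Type*} {b : Module.Basis ι K V}
    {𝔞 : ι → FractionalIdeal (𝓞 K)⁰ K} (h : IsPseudoBasis L b 𝔞) {i : ι} {a : K} (ha : a ∈ 𝔞 i) :
    a • b i ∈ L := by
  classical
  refine (h.mem_iff _).mpr fun j => ?_
  by_cases hij : i = j
  · subst hij; simpa using ha
  · simp [hij, (𝔞 j).zero_mem]

variable {V₁ : Type*} [AddCommGroup V₁] [Module K V₁] [Module (𝓞 K) V₁]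
  [IsScalarTower (𝓞 K) K V₁]
  {V₂ : Type*} [AddCommGroup V₂] [Module K V₂] [Module (𝓞 K) V₂] [IsScalarTower (𝓞 K) K V₂]

omit [Module (𝓞 K) V₂] [IsScalarTower (𝓞 K) K V₂] in
/-- Fractional ideals being invertible, a summand `𝔟 • c` of the image of a lattice `L` lifts to a
summand of `L`. -/
theorem exists_lift (L : Submodule (𝓞 K) V) (p : V →ₗ[K] V₂) {𝔟 : FractionalIdeal (𝓞 K)⁰ K}
    (h𝔟 : 𝔟 ≠ 0) (c : V₂) (hc : ∀ β ∈ 𝔟, ∃ x ∈ L, p x = β • c) :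
    ∃ w : V, p w = c ∧ ∀ β ∈ 𝔟, β • w ∈ L := by
  suffices h : ∀ z ∈ 𝔟 * 𝔟⁻¹, ∃ w : V, p w = z • c ∧ ∀ β ∈ 𝔟, β • w ∈ L by
    obtain ⟨w, hw, hwL⟩ := h 1 (by
      rw [mul_inv_cancel₀ h𝔟]; exact FractionalIdeal.one_mem_one _)
    exact ⟨w, by simpa using hw, hwL⟩
  intro z hz
  refine FractionalIdeal.mul_induction_on hz (fun β hβ γ hγ => ?_) (fun y z hy hz => ?_)
  · obtain ⟨x, hx, hpx⟩ := hc β hβ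
    refine ⟨γ • x, by rw [map_smul, hpx, smul_smul, mul_comm], fun β' hβ' => ?_⟩
    obtain ⟨a, ha⟩ := (FractionalIdeal.mem_one_iff _).mp
      ((FractionalIdeal.mem_inv_iff h𝔟).mp hγ β' hβ')
    rw [smul_smul, mul_comm, ← ha, algebraMap_smul]
    exact L.smul_mem a hx
  · obtain ⟨w, hw, hwL⟩ := hy
    obtain ⟨w', hw', hwL'⟩ := hz
    refine ⟨w + w', by rw [map_add, hw, hw', add_smul], fun β hβ => ?_⟩
    rw [smul_add]
    exact L.add_mem (hwL β hβ) (hwL' β hβ)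

omit [IsScalarTower (𝓞 K) K V₁] [IsScalarTower (𝓞 K) K V₂] in
/-- In a short exact sequence, pseudo-bases of the traces of a lattice on the kernel and on the
quotient combine to a pseudo-basis of the lattice. -/
theorem exists_isPseudoBasis_of_exact (L : Submodule (𝓞 K) V) (i : V₁ →ₗ[K] V) (p : V →ₗ[K] V₂)
    (hi : Function.Injective i) (hip : Function.Exact i p) {ι κ : Type*} [Finite κ]
    {L₁ : Submodule (𝓞 K) V₁} {u : Module.Basis ι K V₁} {𝔞 : ι → FractionalIdeal (𝓞 K)⁰ K}
    (hu : IsPseudoBasis L₁ u 𝔞) (hL₁ : ∀ x, x ∈ L₁ ↔ i x ∈ L)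
    {L₂ : Submodule (𝓞 K) V₂} {c : Module.Basis κ K V₂} {𝔟 : κ → FractionalIdeal (𝓞 K)⁰ K}
    (hc : IsPseudoBasis L₂ c 𝔟) (hL₂ : ∀ y, y ∈ L₂ ↔ ∃ x ∈ L, p x = y) :
    ∃ b : Module.Basis (ι ⊕ κ) K V, (∀ k, b (Sum.inl k) = i (u k)) ∧
      (∀ j, p (b (Sum.inr j)) = c j) ∧ IsPseudoBasis L b (Sum.elim 𝔞 𝔟) := by
  classical
  have := Fintype.ofFinite κ
  -- lifting the basis vectors `c j` along with their coefficient ideals gives a section of `p` which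
  -- maps `L₂` into `L`
  have hw : ∀ j, ∃ w : V, p w = c j ∧ ∀ β ∈ 𝔟 j, β • w ∈ L := fun j =>
    exists_lift L p (hc.ne_zero j) (c j) fun β hβ => (hL₂ _).mp (hc.smul_mem hβ)
  choose w hpw hwL using hw
  set s : V₂ →ₗ[K] V := c.constr K w with hs
  have hps : ∀ y, p (s y) = y := by
    have : p ∘ₗ s = LinearMap.id := c.ext fun j => by simp [hs, hpw]
    exact fun y => congrArg (fun f => f y) this
  have hpi : ∀ x, p (i x) = 0 := fun x => (hip (i x)).mpr ⟨x, rfl⟩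
  let f : (V₁ × V₂) →ₗ[K] V := i.coprod s
  have hf : ∀ x y, f (x, y) = i x + s y := fun x y => by simp [f]
  have hbij : Function.Bijective f := by
    constructor
    · rw [← LinearMap.ker_eq_bot, LinearMap.ker_eq_bot']
      rintro ⟨x, y⟩ h
      rw [hf] at h
      have hy : y = 0 := by simpa [hps, hpi] using congrArg p h
      subst hy
      have hx : x = 0 := hi (by simpa using h)
      rw [hx]; rfl
    · intro z
      obtain ⟨x, hx⟩ := (hip (z - s (p z))).mp (by rw [map_sub, hps, sub_self])
      exact ⟨(x, p z), by rw [hf, hx]; abel⟩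
  let e := LinearEquiv.ofBijective f hbij
  have he : ∀ x y, e (x, y) = i x + s y := hf
  have hsw : ∀ j, s (c j) = w j := fun j => by simp [hs]
  refine ⟨(u.prod c).map e, fun k => ?_, fun j => ?_, ⟨?_, fun z => ?_⟩⟩
  · simp [Module.Basis.map_apply, he]
  · simp [Module.Basis.map_apply, he, hsw, hpw]
  · rintro (k | j)
    · exact hu.ne_zero k
    · exact hc.ne_zero j
  · obtain ⟨⟨x, y⟩, rfl⟩ := e.surjective z
    have h1 : s y ∈ L ↔ y ∈ L₂ := by
      constructor
      · exact fun h => (hL₂ y).mpr ⟨_, h, hps y⟩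
      · intro h
        have hy : s y = ∑ j, c.repr y j • w j := by
          conv_lhs => rw [← c.sum_repr y, map_sum]
          exact Finset.sum_congr rfl fun j _ => by rw [map_smul, hsw]
        rw [hy]
        exact L.sum_mem fun j _ => hwL j _ ((hc.mem_iff y).mp h j)
    have h2 : e (x, y) ∈ L ↔ x ∈ L₁ ∧ y ∈ L₂ := by
      rw [he]
      constructor
      · intro h
        have hy : y ∈ L₂ := (hL₂ y).mpr ⟨_, h, by rw [map_add, hpi, hps, zero_add]⟩
        refine ⟨(hL₁ x).mpr ?_, hy⟩
        simpa using L.sub_mem h (h1.mpr hy)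
      · rintro ⟨hx, hy⟩
        exact L.add_mem ((hL₁ x).mp hx) (h1.mpr hy)
    rw [h2, hu.mem_iff, hc.mem_iff]
    simp [Sum.forall]

/-- The trace of a lattice on a subspace is a lattice. -/
theorem isLattice_comap (L : Submodule (𝓞 K) V) [hL : Submodule.IsLattice K L] (i : V₁ →ₗ[K] V)
    (hi : Function.Injective i) :
    Submodule.IsLattice K (L.comap (i.restrictScalars (𝓞 K))) := by
  constructor
  · have h0 : IsNoetherian (𝓞 K) L := by
      have := Module.Finite.iff_fg.mpr hL.fg
      infer_instance
    have := isNoetherian_of_le (Submodule.map_comap_le (i.restrictScalars (𝓞 K)) L)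
    exact Submodule.fg_of_fg_map_injective (i.restrictScalars (𝓞 K)) hi
      (Module.Finite.iff_fg.mp inferInstance)
  · rw [eq_top_iff]
    rintro x -
    obtain ⟨a, ha, hax⟩ := exists_smul_mem L hL.span_eq_top (i x)
    have ha' : algebraMap (𝓞 K) K a ≠ 0 := by simpa using ha
    rw [← inv_smul_smul₀ ha' x, algebraMap_smul]
    refine Submodule.smul_mem _ _ (Submodule.subset_span ?_)
    simpa using hax

omit [NumberField K] in
/-- The image of a lattice in a quotient is a lattice. -/
theorem isLattice_map (L : Submodule (𝓞 K) V) [hL : Submodule.IsLattice K L] (p : V →ₗ[K] V₂)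
    (hp : Function.Surjective p) :
    Submodule.IsLattice K (L.map (p.restrictScalars (𝓞 K))) := by
  constructor
  · exact hL.fg.map _
  · have h : Submodule.span K (p '' (L : Set V)) = ⊤ := by
      rw [Submodule.span_image, hL.span_eq_top, Submodule.map_top, LinearMap.range_eq_top.mpr hp]
    simpa using h

/-- Steinitz: every lattice has a pseudo-basis. -/
theorem exists_isPseudoBasis [FiniteDimensional K V] (L : Submodule (𝓞 K) V)
    [hL : Submodule.IsLattice K L] :
    ∃ (ι : Type) (_ : Fintype ι) (b : Module.Basis ι K V) (𝔞 : ι → FractionalIdeal (𝓞 K)⁰ K),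
      IsPseudoBasis L b 𝔞 := by
  induction hn : Module.finrank K V generalizing V with
  | zero =>
    have := Module.finrank_zero_iff.mp hn
    refine ⟨Empty, inferInstance, Module.Basis.empty V, fun _ => 1, fun i => i.elim, fun x => ?_⟩
    rw [Subsingleton.elim x 0]
    simp
  | succ n ih =>
    -- split off the image of the lattice, a fractional ideal, under a nonzero linear form `φ`
    let c := Module.finBasisOfFinrankEq K V hn
    let φ : V →ₗ[K] K := c.coord 0
    have hφ : Function.Surjective φ := fun a => ⟨a • c 0, by simp [φ]⟩
    have hker : Module.finrank K (LinearMap.ker φ) = n := by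
      have h := LinearMap.finrank_range_add_finrank_ker φ
      rw [LinearMap.range_eq_top.mpr hφ, finrank_top, Module.finrank_self, hn] at h
      omega
    have h1 := isLattice_comap L (LinearMap.ker φ).subtype (Submodule.injective_subtype _)
    obtain ⟨ι, _, u, 𝔞, hu⟩ :=
      ih (L.comap ((LinearMap.ker φ).subtype.restrictScalars (𝓞 K))) hker
    have h2 := isLattice_map L φ hφ
    let 𝔟 : FractionalIdeal (𝓞 K)⁰ K :=
      ⟨L.map (φ.restrictScalars (𝓞 K)), FractionalIdeal.isFractional_of_fg h2.fg⟩
    have h𝔟 : ∀ a, a ∈ 𝔟 ↔ ∃ x ∈ L, φ x = a := fun a => Iff.rfl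
    have h𝔟0 : 𝔟 ≠ 0 := by
      intro h0
      obtain ⟨a, ha, hax⟩ := exists_smul_mem L hL.span_eq_top (c 0)
      have : φ (a • c 0) ∈ 𝔟 := (h𝔟 _).mpr ⟨_, hax, rfl⟩
      rw [h0, FractionalIdeal.mem_zero_iff, LinearMap.map_smul_of_tower] at this
      simp [φ, Algebra.smul_def, ha] at this
    have hc : IsPseudoBasis (L.map (φ.restrictScalars (𝓞 K))) (Module.Basis.singleton Unit K)
        (fun _ => 𝔟) := ⟨fun _ => h𝔟0, fun x => by simp [h𝔟]⟩
    obtain ⟨b, -, -, hb⟩ := exists_isPseudoBasis_of_exact L (LinearMap.ker φ).subtype φ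
      (Submodule.injective_subtype _) (LinearMap.exact_subtype_ker_map φ) hu (fun _ => Iff.rfl) hc
      (fun _ => Iff.rfl)
    exact ⟨ι ⊕ Unit, inferInstance, b, _, hb⟩

end PseudoBasis

/-! ### Contractions and heights of subspaces -/

section Contraction

variable {K : Type u} [Field K] [NumberField K]
  {A : RigidAdelicSpace.{u, v} K} {B : RigidAdelicSpace.{u, w} K}

theorem gram_posSemidef (A : RigidAdelicSpace.{u, v} K) (γ : K →+* ℂ) {ι : Type*} [Fintype ι]
    (x : ι → A.carrier) : (gram (A.herm γ) x).PosSemidef := by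
  set b := Module.finBasis K A.carrier
  have hx : x = fun j => ∑ i, b.toMatrix x i j • b i := by
    funext j
    exact (b.sum_toMatrix_smul_self x j).symm
  rw [hx, gram_change]
  exact (A.gram_posDef γ b b.linearIndependent).posSemidef.conjTranspose_mul_mul_same _

open scoped Pointwise in
/-- A submodule `⨁ 𝔟 i • b i` of the lattice bounds its determinant ideal from below. -/
theorem prod_le_detIdeal (A : RigidAdelicSpace.{u, v} K) {ι : Type*} [Fintype ι] [DecidableEq ι]
    (b : Module.Basis ι K A.carrier) (𝔟 : ι → FractionalIdeal (𝓞 K)⁰ K)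
    (h : ∀ i, ∀ a ∈ 𝔟 i, a • b i ∈ A.lattice) : ∏ i, 𝔟 i ≤ A.detIdeal b := by
  have hprod : ((∏ i, 𝔟 i : FractionalIdeal (𝓞 K)⁰ K) : Submodule (𝓞 K) K) =
      ∏ i, (𝔟 i : Submodule (𝓞 K) K) :=
    map_prod (FractionalIdeal.coeSubmoduleHom (𝓞 K)⁰ K) _ _
  have hspan : ∏ i, (𝔟 i : Submodule (𝓞 K) K) =
      Submodule.span (𝓞 K) (∏ i, ((𝔟 i : Submodule (𝓞 K) K) : Set K)) := by
    rw [← Submodule.prod_span]; simp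
  rw [← FractionalIdeal.coe_le_coe, hprod, hspan, Submodule.span_le]
  intro z hz
  obtain ⟨g, hg, rfl⟩ := (Set.mem_fintype_prod _ _).mp hz
  refine Submodule.subset_span ⟨fun i => g i • b i, fun i => h i _ (hg i), ?_⟩
  have : b.toMatrix (fun i => g i • b i) = Matrix.diagonal g := by
    ext i j
    by_cases hij : i = j
    · subst hij; simp [Module.Basis.toMatrix_apply]
    · simp [Module.Basis.toMatrix_apply, hij]
  rw [Module.Basis.det_apply, this, Matrix.det_diagonal]

theorem height_nonneg (A : RigidAdelicSpace.{u, v} K) : 0 ≤ A.height := by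
  rw [height, heightIn]
  refine Real.rpow_nonneg (mul_nonneg (by exact_mod_cast FractionalIdeal.absNorm_nonneg _)
    (Finset.prod_nonneg fun w _ => Real.rpow_nonneg ?_ _)) _
  exact (Complex.le_def.mp (A.gram_posDef w.embedding _
    (Module.finBasis K A.carrier).linearIndependent).det_pos.le).1

/-- A linear map `p : A → B` which maps the lattice into the lattice and satisfies
`c * ‖p z‖ ^ 2 ≤ ‖z‖ ^ 2` at every infinite place, for all vectors `z` with complex coefficients
(expressed by the positivity of the difference of Gram matrices). -/
structure IsContraction (A : RigidAdelicSpace.{u, v} K) (B : RigidAdelicSpace.{u, w} K)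
    (p : A.carrier →ₗ[K] B.carrier) (c : ℝ) : Prop where
  map_mem : ∀ x ∈ A.lattice, p x ∈ B.lattice
  posSemidef : ∀ (γ : K →+* ℂ) {ι : Type} [Fintype ι] (x : ι → A.carrier),
    (gram (A.herm γ) x - (c : ℂ) • gram (B.herm γ) (fun i => p (x i))).PosSemidef

/-- The product over the infinite places in the height, for a constant. -/
theorem prod_const_rpow {c : ℝ} (hc : 0 ≤ c) (n : ℕ) :
    (∏ w : InfinitePlace K, (c ^ n) ^ ((w.mult : ℝ) / 2)) ^ (1 / (Module.finrank ℚ K : ℝ)) =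
      Real.sqrt c ^ n := by
  have hD : (Module.finrank ℚ K : ℝ) ≠ 0 := by
    exact_mod_cast (Module.finrank_pos (R := ℚ) (M := K)).ne'
  have h0 : 0 ≤ c ^ n := pow_nonneg hc n
  have h1 : ∏ w : InfinitePlace K, (c ^ n) ^ ((w.mult : ℝ) / 2) =
      (Real.sqrt (c ^ n)) ^ (Module.finrank ℚ K : ℕ) := by
    rw [← InfinitePlace.sum_mult_eq, ← Finset.prod_pow_eq_pow_sum]
    refine Finset.prod_congr rfl fun w _ => ?_
    rw [Real.sqrt_eq_rpow, ← Real.rpow_mul_natCast h0]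
    congr 1; ring
  rw [h1, one_div, Real.pow_rpow_inv_natCast (Real.sqrt_nonneg _) (by exact_mod_cast hD)]
  rw [Real.sqrt_eq_rpow, Real.sqrt_eq_rpow, ← Real.rpow_natCast, ← Real.rpow_natCast,
    ← Real.rpow_mul hc, ← Real.rpow_mul hc, mul_comm]

/-- The inequality between heights which results from inequalities between their factors. -/
theorem rpow_prod_mul_le {c : ℝ} (hc : 0 ≤ c) (n : ℕ) {P S G : InfinitePlace K → ℝ}
    (hP : ∀ w, 0 ≤ P w) (hS : ∀ w, 0 ≤ S w) (h : ∀ w, P w * (c ^ n * S w) ≤ G w)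
    {n₁ n₂ n₂' : ℝ} (hn₁ : 0 ≤ n₁) (hn₂ : 0 ≤ n₂) (hn : n₂ ≤ n₂') {x₁ x₂ x : ℝ}
    (hx₁ : x₁ = (n₁ * ∏ w, P w ^ ((w.mult : ℝ) / 2)) ^ (1 / (Module.finrank ℚ K : ℝ)))
    (hx₂ : x₂ = (n₂ * ∏ w, S w ^ ((w.mult : ℝ) / 2)) ^ (1 / (Module.finrank ℚ K : ℝ)))
    (hx : x = (n₁ * n₂' * ∏ w, G w ^ ((w.mult : ℝ) / 2)) ^ (1 / (Module.finrank ℚ K : ℝ))) :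
    x₁ * (Real.sqrt c ^ n * x₂) ≤ x := by
  have hc0 : 0 ≤ c ^ n := pow_nonneg hc _
  have hP' : 0 ≤ ∏ w, P w ^ ((w.mult : ℝ) / 2) :=
    Finset.prod_nonneg fun w _ => Real.rpow_nonneg (hP w) _
  have hS' : 0 ≤ ∏ w, S w ^ ((w.mult : ℝ) / 2) :=
    Finset.prod_nonneg fun w _ => Real.rpow_nonneg (hS w) _
  have hc' : 0 ≤ ∏ w : InfinitePlace K, (c ^ n) ^ ((w.mult : ℝ) / 2) :=
    Finset.prod_nonneg fun w _ => Real.rpow_nonneg hc0 _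
  have hprod : ∏ w, (P w * (c ^ n * S w)) ^ ((w.mult : ℝ) / 2) =
      (∏ w, P w ^ ((w.mult : ℝ) / 2)) * ((∏ w : InfinitePlace K, (c ^ n) ^ ((w.mult : ℝ) / 2)) *
        ∏ w, S w ^ ((w.mult : ℝ) / 2)) := by
    rw [← Finset.prod_mul_distrib, ← Finset.prod_mul_distrib]
    exact Finset.prod_congr rfl fun w _ => by
      rw [Real.mul_rpow (hP w) (mul_nonneg hc0 (hS w)), Real.mul_rpow hc0 (hS w)]
  have hle : ∏ w, (P w * (c ^ n * S w)) ^ ((w.mult : ℝ) / 2) ≤ ∏ w, G w ^ ((w.mult : ℝ) / 2) :=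
    Finset.prod_le_prod (fun w _ => Real.rpow_nonneg (mul_nonneg (hP w)
      (mul_nonneg hc0 (hS w))) _) fun w _ => Real.rpow_le_rpow
        (mul_nonneg (hP w) (mul_nonneg hc0 (hS w))) (h w) (by positivity)
  rw [hx₁, hx₂, hx, ← prod_const_rpow (K := K) hc, ← Real.mul_rpow hc' (mul_nonneg hn₂ hS'),
    ← Real.mul_rpow (mul_nonneg hn₁ hP') (mul_nonneg hc' (mul_nonneg hn₂ hS'))]
  refine Real.rpow_le_rpow (by positivity) ?_ (by positivity)
  calc _ = n₁ * n₂ * ∏ w, (P w * (c ^ n * S w)) ^ ((w.mult : ℝ) / 2) := by rw [hprod]; ring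
    _ ≤ n₁ * n₂' * ∏ w, (P w * (c ^ n * S w)) ^ ((w.mult : ℝ) / 2) :=
        mul_le_mul_of_nonneg_right (mul_le_mul_of_nonneg_left hn hn₁)
          (by rw [hprod]; positivity)
    _ ≤ _ := mul_le_mul_of_nonneg_left hle (mul_nonneg hn₁ (hn₂.trans hn))

/-- The comparison of heights behind everything else: under a contraction, the height of a subspace
is at least the product of the heights of its intersection with the kernel and of its image. -/
theorem IsContraction.height_mul_height_le {p : A.carrier →ₗ[K] B.carrier} {c : ℝ}
    (h : IsContraction A B p c) (hc : 0 < c) (W : Submodule K A.carrier) :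
    (A.sub (W ⊓ LinearMap.ker p)).height *
      (Real.sqrt c ^ Module.finrank K (W.map p) * (B.sub (W.map p)).height) ≤
        (A.sub W).height := by
  classical
  -- a pseudo-basis of the lattice of `W` adapted to the kernel `W ⊓ ker p` of `q : W → p W`; the
  -- quotient carries the image `q L`, which may be smaller than the lattice of `p W`
  let L : Submodule (𝓞 K) W := A.lattice.comap (W.subtype.restrictScalars (𝓞 K))
  have hL : Submodule.IsLattice K L := (A.sub W).isLattice
  let L₁ : Submodule (𝓞 K) (W ⊓ LinearMap.ker p : Submodule K A.carrier) :=
    A.lattice.comap ((W ⊓ LinearMap.ker p).subtype.restrictScalars (𝓞 K))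
  have hL₁ : Submodule.IsLattice K L₁ := (A.sub (W ⊓ LinearMap.ker p)).isLattice
  let i : (W ⊓ LinearMap.ker p : Submodule K A.carrier) →ₗ[K] W :=
    Submodule.inclusion inf_le_left
  let q : W →ₗ[K] W.map p := p.submoduleMap W
  have hq : ∀ x : W, (q x : B.carrier) = p x := fun x => rfl
  have hqs : Function.Surjective q := p.submoduleMap_surjective W
  have hi : Function.Injective i := Submodule.inclusion_injective _
  have hiq : Function.Exact i q := by
    intro x
    constructor
    · intro hx
      have : p x = 0 := by rw [← hq, hx]; rfl
      exact ⟨⟨x, x.2, this⟩, rfl⟩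
    · rintro ⟨y, rfl⟩
      exact Subtype.ext y.2.2
  have h2 := isLattice_map L q hqs
  obtain ⟨ι, _, u, 𝔞, hu⟩ :=
    exists_isPseudoBasis L₁
  obtain ⟨κ, _, e, 𝔟, he⟩ := exists_isPseudoBasis (L.map (q.restrictScalars (𝓞 K)))
  obtain ⟨b, hbu, hbe, hb⟩ := exists_isPseudoBasis_of_exact L i q hi hiq hu (fun _ => Iff.rfl) he
    (fun _ => Iff.rfl)
  have H : (A.sub W).height = _ := height_eq_of_pseudoBasis (A.sub W) b (Sum.elim 𝔞 𝔟) hb.mem_iff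
  have H1 : (A.sub (W ⊓ LinearMap.ker p)).height = _ :=
    height_eq_of_pseudoBasis (A.sub (W ⊓ LinearMap.ker p)) u 𝔞 hu.mem_iff
  have H2 : (B.sub (W.map p)).height = (B.sub (W.map p)).heightIn (ι := κ) e := 
    height_eq_heightIn (B.sub (W.map p)) e
  have hprod : ∏ j, 𝔟 j ≤ (B.sub (W.map p)).detIdeal e := by
    refine prod_le_detIdeal _ _ _ fun j a ha => ?_
    obtain ⟨x, hx, hxa⟩ := he.smul_mem ha
    change ((a • e j : W.map p) : B.carrier) ∈ B.lattice
    rw [← hxa]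
    exact h.map_mem _ hx
  have hne : ∏ j, 𝔟 j ≠ 0 := Finset.prod_ne_zero_iff.mpr fun j _ => he.ne_zero j
  have hnorm := absNorm_le_absNorm hne hprod
  have hPD1 : ∀ w : InfinitePlace K, (gram ((A.sub (W ⊓ LinearMap.ker p)).herm w.embedding)
      u).PosDef := fun w => gram_posDef _ _ _ u.linearIndependent
  have hPD2 : ∀ w : InfinitePlace K, (gram ((B.sub (W.map p)).herm w.embedding) e).PosDef :=
    fun w => gram_posDef _ _ _ e.linearIndependent
  -- in the adapted basis the Gram matrix of `W` has the one of the kernel as its first block and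
  -- dominates `c` times the one of the image, placed in the second block
  have hdet : ∀ w : InfinitePlace K,
      (gram ((A.sub (W ⊓ LinearMap.ker p)).herm w.embedding) u).det.re *
        (c ^ Fintype.card κ * (gram ((B.sub (W.map p)).herm w.embedding) e).det.re) ≤
      (gram ((A.sub W).herm w.embedding) b).det.re := by
    intro w
    set P := gram ((A.sub (W ⊓ LinearMap.ker p)).herm w.embedding) u with hP
    set S := gram ((B.sub (W.map p)).herm w.embedding) e with hS
    set G := gram ((A.sub W).herm w.embedding) b with hG
    have hGP : G.toBlocks₁₁ = P := by
      ext k l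
      change A.herm w.embedding (b (Sum.inl k) : W) (b (Sum.inl l) : W) = _
      rw [hbu, hbu]
      rfl
    have hpsd := h.posSemidef w.embedding (fun k => ((b k : W) : A.carrier))
    have hGS : G - (c : ℂ) • gram (B.herm w.embedding) (fun k => p (b k : W)) =
        Matrix.fromBlocks P G.toBlocks₁₂ G.toBlocks₂₁ (G.toBlocks₂₂ - (c : ℂ) • S) := by
      have hz : ∀ k, p (b (Sum.inl k) : W) = 0 := fun k => by
        rw [hbu]; exact (u k).2.2
      have hp : ∀ j, p (b (Sum.inr j) : W) = e j := fun j => by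
        rw [← hbe]; rfl
      rw [← hGP]
      ext (k | k) (l | l)
      · simp [gram, hz, Matrix.toBlocks₁₁]
      · simp [gram, hz, Matrix.toBlocks₁₂]
      · simp [gram, hz, Matrix.toBlocks₂₁]
      · simp only [gram, hp, Matrix.sub_apply, Matrix.smul_apply, Matrix.of_apply,
          Matrix.fromBlocks_apply₂₂, hS, Matrix.toBlocks₂₂]
        rfl
    have hle := det_mul_det_le_det_fromBlocks (R := G.toBlocks₂₂) (hPD1 w)
      ((hPD2 w).smul (show (0 : ℂ) < (c : ℂ) by exact_mod_cast hc)) (hGS ▸ hpsd)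
    have hG' : Matrix.fromBlocks P G.toBlocks₁₂ G.toBlocks₂₁ G.toBlocks₂₂ = G := by
      rw [← hGP, Matrix.fromBlocks_toBlocks]
    rw [hG', Matrix.det_smul, ← hP, ← hS] at hle
    have hPr : P.det = (P.det.re : ℂ) := Complex.eq_re_of_ofReal_le (hPD1 w).det_pos.le
    have hSr : S.det = (S.det.re : ℂ) := Complex.eq_re_of_ofReal_le (hPD2 w).det_pos.le
    rw [hPr, hSr] at hle
    have := (Complex.le_def.mp hle).1
    exact_mod_cast this
  have hP0 : ∀ w : InfinitePlace K,
      0 ≤ (gram ((A.sub (W ⊓ LinearMap.ker p)).herm w.embedding) u).det.re := fun w =>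
    (Complex.le_def.mp (hPD1 w).det_pos.le).1
  have hS0 : ∀ w : InfinitePlace K,
      0 ≤ (gram ((B.sub (W.map p)).herm w.embedding) e).det.re := fun w =>
    (Complex.le_def.mp (hPD2 w).det_pos.le).1
  rw [Module.finrank_eq_card_basis e]
  refine rpow_prod_mul_le hc.le _ hP0 hS0 hdet
    (n₁ := ((FractionalIdeal.absNorm (∏ k, 𝔞 k) : ℚ) : ℝ))
    (n₂' := ((FractionalIdeal.absNorm (∏ j, 𝔟 j) : ℚ) : ℝ)) ?_ ?_ (by exact_mod_cast hnorm)
    H1 H2 (H.trans ?_)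
  · exact_mod_cast FractionalIdeal.absNorm_nonneg _
  · exact_mod_cast FractionalIdeal.absNorm_nonneg _
  · rw [Fintype.prod_sum_type, map_mul, Rat.cast_mul]
    rfl

theorem height_of_subsingleton (A : RigidAdelicSpace.{u, v} K) [Subsingleton A.carrier] :
    A.height = 1 := by
  rw [height_eq_of_pseudoBasis A (Module.Basis.empty (ι := Empty) A.carrier) (fun _ => 1)
    (fun x => by rw [Subsingleton.elim x 0]; simp)]
  simp

theorem height_sub_bot (A : RigidAdelicSpace.{u, v} K) : (A.sub ⊥).height = 1 :=
  have : Subsingleton (A.sub ⊥).carrier :=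
    inferInstanceAs (Subsingleton (⊥ : Submodule K A.carrier))
  height_of_subsingleton _

/-- The height of a subspace on which a contraction is injective. -/
theorem IsContraction.height_map_le {p : A.carrier →ₗ[K] B.carrier} {c : ℝ}
    (h : IsContraction A B p c) (hc : 0 < c) (W : Submodule K A.carrier)
    (hW : W ⊓ LinearMap.ker p = ⊥) :
    Real.sqrt c ^ Module.finrank K (W.map p) * (B.sub (W.map p)).height ≤ (A.sub W).height := by
  have := h.height_mul_height_le hc W
  rwa [hW, height_sub_bot, one_mul] at this

end Contraction

/-! ### Positivity of the minimal height -/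

section Positivity

variable {K : Type u} [Field K] [NumberField K]

/-- The standard rigid adelic space of dimension one.  It is reducible, so that its vectors are
elements of `K`. -/
noncomputable abbrev line (K : Type u) [Field K] [NumberField K] : RigidAdelicSpace.{u, u} K where
  carrier := K
  lattice := (1 : FractionalIdeal (𝓞 K)⁰ K)
  isLattice := by
    constructor
    · rw [FractionalIdeal.coe_one, Submodule.one_eq_span]
      exact Submodule.fg_span_singleton 1
    · rw [eq_top_iff]
      rintro x -
      rw [← mul_one x, ← smul_eq_mul]
      exact Submodule.smul_mem _ _ (Submodule.subset_span (FractionalIdeal.one_mem_one _))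
  herm γ := LinearMap.mk₂'ₛₗ _ _ (fun x y => conj (γ x) * γ y)
    (fun _ _ _ => by simp only [map_add, add_mul])
    (fun _ _ _ => by simp only [smul_eq_mul, map_mul, RingHom.comp_apply, mul_assoc])
    (fun _ _ _ => by simp only [map_add, mul_add])
    (fun _ _ _ => by simp only [smul_eq_mul, map_mul]; ring)
  herm_symm γ x y := by simp [mul_comm]
  herm_conjugate γ x y := by simp
  herm_posDef γ n x hx := by
    refine posDef_gram_of_basis _ (Module.Basis.singleton Unit K) ?_ x hx
    convert Matrix.PosDef.one (n := Unit) (R := ℂ)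
    ext i j
    simp [gram]

theorem height_line_sub (W : Submodule K K) : ((line K).sub W).height = 1 := by
  rcases eq_bot_or_eq_top W with rfl | rfl
  · exact height_sub_bot _
  · let b : Module.Basis Unit K (⊤ : Submodule K K) :=
      (Module.Basis.singleton Unit K).map Submodule.topEquiv.symm
    have hb : ∀ i, ((b i : (⊤ : Submodule K K)) : K) = 1 := fun i => by simp [b]
    have hr : ∀ (x : (⊤ : Submodule K K)) (i : Unit), b.repr x i = x := fun x i => by simp [b]
    have hmem : ∀ x : (⊤ : Submodule K K), (x : K) ∈ (1 : FractionalIdeal (𝓞 K)⁰ K) ↔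
        ∀ i, b.repr x i ∈ (1 : FractionalIdeal (𝓞 K)⁰ K) := fun x => by simp [hr]
    have h := height_eq_of_pseudoBasis ((line K).sub ⊤) b (fun _ => 1) hmem
    have hg : ∀ γ : K →+* ℂ, (gram (((line K).sub ⊤).herm γ) b).det = 1 := by
      intro γ
      have : conj (γ (b () : (⊤ : Submodule K K))) * γ (b () : (⊤ : Submodule K K)) = 1 := by
        rw [hb]
        simp
      rw [Matrix.det_unique]
      exact this
    have h1 : ∀ r : ℝ, r = 1 → (((FractionalIdeal.absNorm (∏ _ : Unit,
        (1 : FractionalIdeal (𝓞 K)⁰ K)) : ℚ) : ℝ) * r) ^ (1 / (Module.finrank ℚ K : ℝ)) = 1 := by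
      rintro _ rfl
      simp
    exact h.trans (h1 _ (Finset.prod_eq_one fun w _ =>
      (congrArg (fun z : ℂ => z.re ^ ((w.mult : ℝ) / 2)) (hg w.embedding)).trans (by simp)))

/-- A linear form, integral on the lattice, is a contraction as soon as its operator norms are
bounded. -/
theorem isContraction_line {A : RigidAdelicSpace.{u, v} K} (f : Module.Dual K A.carrier) {c : ℝ}
    {ι : Type*} [Fintype ι] [DecidableEq ι] (b : Module.Basis ι K A.carrier) (hc0 : 0 ≤ c)
    (hf : ∀ x ∈ A.lattice, ∃ a : 𝓞 K, f x = algebraMap (𝓞 K) K a)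
    (hc : ∀ γ, c * (dualForm (A.herm γ) b f f).re ≤ 1) : IsContraction A (line K) f c where
  map_mem x hx := by
    obtain ⟨a, ha⟩ := hf x hx
    exact (FractionalIdeal.mem_one_iff (𝓞 K)⁰).mpr ⟨a, ha.symm⟩
  posSemidef γ {κ} _ x := by
    have hb : (gram (A.herm γ) b -
        (c : ℂ) • gram ((line K).herm γ) (fun i => f (b i))).PosSemidef := by
      have hG := A.gram_posDef γ b b.linearIndependent
      have hS : (gram ((line K).herm γ) (fun i => f (b i))).IsHermitian :=
        ((line K).gram_posSemidef γ _).isHermitian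
      refine .of_dotProduct_mulVec_nonneg (hG.isHermitian.sub ?_) fun z => ?_
      · rw [Matrix.IsHermitian, Matrix.conjTranspose_smul, hS.eq]
        simp
      · by_cases hz : z = 0
        · simp [hz]
        have hι : Nonempty ι := by
          by_contra h
          rw [not_nonempty_iff] at h
          exact hz (Subsingleton.elim _ _)
        have h1 : star z ⬝ᵥ (gram ((line K).herm γ) (fun i => f (b i))).mulVec z =
            ((‖∑ i, z i * γ (f (b i))‖ ^ 2 : ℝ) : ℂ) := by
          have : star z ⬝ᵥ (gram ((line K).herm γ) (fun i => f (b i))).mulVec z =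
              conj (∑ i, z i * γ (f (b i))) * ∑ i, z i * γ (f (b i)) := by
            simp only [dotProduct, Matrix.mulVec, gram, Matrix.of_apply, LinearMap.mk₂'ₛₗ_apply, map_sum,
              map_mul, Finset.sum_mul, Finset.mul_sum, Pi.star_apply, starRingEnd_apply]
            rw [Finset.sum_comm]
            exact Finset.sum_congr rfl fun i _ => Finset.sum_congr rfl fun j _ => by ring
          rw [this, Complex.conj_mul']
          push_cast; rfl
        have hpos := hG.re_dotProduct_pos hz
        have hre : star z ⬝ᵥ (gram (A.herm γ) b).mulVec z =
            ((star z ⬝ᵥ (gram (A.herm γ) b).mulVec z).re : ℂ) :=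
          Complex.eq_re_of_ofReal_le (hG.posSemidef.dotProduct_mulVec_nonneg z)
        have h2 := (isGreatest_dualForm (A.herm γ) b hG f).2 ⟨z, hz, rfl⟩
        replace hpos : 0 < (star z ⬝ᵥ (gram (A.herm γ) b).mulVec z).re := hpos
        rw [div_le_iff₀ hpos] at h2
        rw [Matrix.sub_mulVec, dotProduct_sub, Matrix.smul_mulVec, dotProduct_smul, h1, hre,
          smul_eq_mul, ← Complex.ofReal_mul, ← Complex.ofReal_sub, Complex.zero_le_real, sub_nonneg]
        calc _ ≤ c * ((dualForm (A.herm γ) b f f).re *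
              (star z ⬝ᵥ (gram (A.herm γ) b).mulVec z).re) := mul_le_mul_of_nonneg_left h2 hc0
          _ ≤ _ := by
            rw [← mul_assoc]
            exact mul_le_of_le_one_left hpos.le (hc γ)
    have hx : x = fun j => ∑ i, b.toMatrix x i j • b i := by
      funext j
      exact (b.sum_toMatrix_smul_self x j).symm
    have hfx : (fun j => f (x j)) = fun j => ∑ i, b.toMatrix x i j • f (b i) := by
      funext j
      conv_lhs => rw [← b.sum_toMatrix_smul_self x j, map_sum]
      exact Finset.sum_congr rfl fun i _ => map_smul f _ _
    have e1 := gram_change (A.herm γ) b (b.toMatrix x)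
    rw [← hx] at e1
    have e2 : gram ((line K).herm γ) (fun j => f (x j)) =
        ((b.toMatrix x).map γ).conjTranspose * gram ((line K).herm γ) (fun i => f (b i)) *
          (b.toMatrix x).map γ := by
      rw [hfx]
      exact gram_change ((line K).herm γ) (fun i => f (b i)) (b.toMatrix x)
    rw [e1, e2, ← Matrix.smul_mul, ← Matrix.mul_smul, ← Matrix.sub_mul, ← Matrix.mul_sub]
    exact hb.conjTranspose_mul_mul_same _

omit [NumberField K] in
theorem finrank_map_add_finrank_inf_ker {V V' : Type*} [AddCommGroup V] [Module K V]
    [FiniteDimensional K V] [AddCommGroup V'] [Module K V'] (p : V →ₗ[K] V') (W : Submodule K V) :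
    Module.finrank K (W.map p) + Module.finrank K (W ⊓ LinearMap.ker p : Submodule K V) =
      Module.finrank K W := by
  have h := LinearMap.finrank_range_add_finrank_ker (p.domRestrict W)
  rw [LinearMap.range_domRestrict] at h
  rw [← h, LinearMap.ker_domRestrict]
  congr 1
  rw [← Submodule.finrank_map_subtype_eq W ((LinearMap.ker p).comap W.subtype),
    Submodule.map_comap_subtype]

/-- The heights of the subspaces of a rigid adelic space are bounded below, uniformly up to
normalisation by the dimension. -/
theorem exists_pow_finrank_le_height (A : RigidAdelicSpace.{u, v} K) :
    ∃ m : ℝ, 0 < m ∧ ∀ W : Submodule K A.carrier,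
      m ^ Module.finrank K W ≤ (A.sub W).height := by
  classical
  -- multiples `f i` of the coordinate forms which are integral on the lattice; by the choice of `M`
  -- they are all contractions onto the line, with the same constant `M⁻¹`
  let b := Module.finBasis K A.carrier
  choose d hd hdL using fun i => exists_denom A.lattice Submodule.IsLattice.fg (b.coord i)
  let f : Fin (Module.finrank K A.carrier) → Module.Dual K A.carrier := fun i =>
    algebraMap (𝓞 K) K (d i) • b.coord i
  have hD0 : ∀ γ i, 0 ≤ (dualForm (A.herm γ) b (f i) (f i)).re := by
    intro γ i
    have : Nonempty (Fin (Module.finrank K A.carrier)) := ⟨i⟩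
    have hG := A.gram_posDef γ b b.linearIndependent
    refine le_trans ?_ ((isGreatest_dualForm (A.herm γ) b hG (f i)).2 ⟨1, one_ne_zero, rfl⟩)
    exact div_nonneg (by positivity) (hG.posSemidef.re_dotProduct_nonneg _)
  set M : ℝ := 1 + ∑ γ : K →+* ℂ, ∑ i, (dualForm (A.herm γ) b (f i) (f i)).re with hM
  have hM1 : 1 ≤ M := le_add_of_nonneg_right
    (Finset.sum_nonneg fun γ _ => Finset.sum_nonneg fun i _ => hD0 γ i)
  have hMi : ∀ γ i, (dualForm (A.herm γ) b (f i) (f i)).re ≤ M := by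
    intro γ i
    have h1 := Finset.single_le_sum (f := fun i => (dualForm (A.herm γ) b (f i) (f i)).re)
      (fun i _ => hD0 γ i) (Finset.mem_univ i)
    have h2 := Finset.single_le_sum
      (f := fun γ => ∑ i, (dualForm (A.herm γ) b (f i) (f i)).re)
      (fun γ _ => Finset.sum_nonneg fun i _ => hD0 γ i) (Finset.mem_univ γ)
    linarith
  have hM0 : 0 < M := by linarith
  have hc : 0 < M⁻¹ := inv_pos.mpr hM0
  have hf : ∀ i, IsContraction A (line K) (f i) M⁻¹ := by
    intro i
    refine isContraction_line (f i) b hc.le (fun x hx => ?_) fun γ => ?_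
    · obtain ⟨a, ha⟩ := hdL i x hx
      refine ⟨a, ?_⟩
      rw [← ha, LinearMap.map_smul_of_tower, LinearMap.smul_apply, algebraMap_smul]
    · rw [inv_mul_le_iff₀ hM0, mul_one]
      exact hMi γ i
  -- cut `W` successively by the kernels of the `f i`, `i ∈ s`, until nothing is left
  have key : ∀ (s : Finset (Fin (Module.finrank K A.carrier))) (W : Submodule K A.carrier),
      (∀ x ∈ W, (∀ i ∈ s, f i x = 0) → x = 0) →
        Real.sqrt M⁻¹ ^ Module.finrank K W ≤ (A.sub W).height := by
    intro s
    induction s using Finset.induction_on with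
    | empty =>
      intro W hW
      have : W = ⊥ := (Submodule.eq_bot_iff W).mpr fun x hx => hW x hx (by simp)
      subst this
      rw [height_sub_bot, finrank_bot, pow_zero]
    | insert i s _ ih =>
      intro W hW
      have h1 := ih (W ⊓ LinearMap.ker (f i)) fun x hx h => hW x hx.1 fun j hj => by
        rcases Finset.mem_insert.mp hj with rfl | hj
        · exact hx.2
        · exact h j hj
      have h2 := (hf i).height_mul_height_le hc W
      have h3 : ((line K).sub (W.map (f i))).height = 1 := height_line_sub _
      have h4 := finrank_map_add_finrank_inf_ker (f i) W
      rw [h3, mul_one] at h2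
      refine le_trans ?_ h2
      rw [← h4, add_comm, pow_add]
      exact mul_le_mul_of_nonneg_right h1 (by positivity)
  refine ⟨Real.sqrt M⁻¹, Real.sqrt_pos.mpr hc, fun W => key Finset.univ W fun x _ hx => ?_⟩
  refine b.ext_elem fun i => ?_
  have := hx i (Finset.mem_univ i)
  simpa [f, hd i] using this

theorem reducedHeight_nonneg (A : RigidAdelicSpace.{u, v} K) : 0 ≤ A.reducedHeight :=
  Real.rpow_nonneg A.height_nonneg _

theorem minHeight_nonneg (A : RigidAdelicSpace.{u, v} K) : 0 ≤ A.minHeight :=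
  Real.iInf_nonneg fun W => (A.sub W.1).reducedHeight_nonneg

theorem minHeight_le_reducedHeight (A : RigidAdelicSpace.{u, v} K) {W : Submodule K A.carrier}
    (hW : W ≠ ⊥) : A.minHeight ≤ (A.sub W).reducedHeight :=
  ciInf_le (f := fun W : {W : Submodule K A.carrier // W ≠ ⊥} => (A.sub W.1).reducedHeight)
    ⟨0, by rintro _ ⟨W, rfl⟩; exact reducedHeight_nonneg _⟩ ⟨W, hW⟩

theorem reducedHeight_pow_finrank (A : RigidAdelicSpace.{u, v} K) [Nontrivial A.carrier] :
    A.reducedHeight ^ Module.finrank K A.carrier = A.height := by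
  rw [reducedHeight, one_div, Real.rpow_inv_natCast_pow A.height_nonneg
    (Module.finrank_pos (R := K) (M := A.carrier)).ne']

theorem le_reducedHeight_iff (A : RigidAdelicSpace.{u, v} K) [Nontrivial A.carrier] {m : ℝ}
    (hm : 0 ≤ m) : m ≤ A.reducedHeight ↔ m ^ Module.finrank K A.carrier ≤ A.height := by
  rw [← reducedHeight_pow_finrank]
  exact (pow_le_pow_iff_left₀ hm A.reducedHeight_nonneg Module.finrank_pos.ne').symm

theorem minHeight_pow_le_height (A : RigidAdelicSpace.{u, v} K) (W : Submodule K A.carrier) :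
    A.minHeight ^ Module.finrank K W ≤ (A.sub W).height := by
  by_cases hW : W = ⊥
  · subst hW
    rw [height_sub_bot, finrank_bot, pow_zero]
  · have : Nontrivial (A.sub W).carrier := Submodule.nontrivial_iff_ne_bot.mpr hW
    exact (le_reducedHeight_iff (A.sub W) A.minHeight_nonneg).mp (A.minHeight_le_reducedHeight hW)

/-- Lower bounds for the minimal height, without division by the dimension.  The infimum defining
`minHeight` is over a nonempty set only for nonzero spaces. -/
theorem le_minHeight (A : RigidAdelicSpace.{u, v} K) [Nontrivial A.carrier] {m : ℝ} (hm : 0 ≤ m)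
    (h : ∀ W : Submodule K A.carrier, m ^ Module.finrank K W ≤ (A.sub W).height) :
    m ≤ A.minHeight := by
  have : Nonempty {W : Submodule K A.carrier // W ≠ ⊥} := ⟨⟨⊤, top_ne_bot⟩⟩
  refine le_ciInf fun W => ?_
  have : Nontrivial (A.sub W.1).carrier := Submodule.nontrivial_iff_ne_bot.mpr W.2
  exact (le_reducedHeight_iff (A.sub W.1) hm).mpr (h W.1)

theorem minHeight_pos (A : RigidAdelicSpace.{u, v} K) [Nontrivial A.carrier] : 0 < A.minHeight := by
  obtain ⟨m, hm, h⟩ := A.exists_pow_finrank_le_height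
  exact hm.trans_le (A.le_minHeight hm.le h)

end Positivity

/-! ### Minimal heights of orthogonal sums -/

section OrthogonalSum

universe v₁ v₂ v₃

variable {K : Type u} [Field K] [NumberField K]

/-- A presentation of `C` as the orthogonal direct sum of `A` and of the space `B` with its Hermitian
forms multiplied by `t`. -/
structure OrthogonalSum (C : RigidAdelicSpace.{u, v₁} K) (A : RigidAdelicSpace.{u, v₂} K)
    (B : RigidAdelicSpace.{u, v₃} K) (t : ℝ) where
  /-- the projection to `A` -/
  fst : C.carrier →ₗ[K] A.carrier
  /-- the projection to `B` -/
  snd : C.carrier →ₗ[K] B.carrier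
  /-- the inclusion of `A` -/
  inl : A.carrier →ₗ[K] C.carrier
  /-- the inclusion of `B` -/
  inr : B.carrier →ₗ[K] C.carrier
  fst_inl : fst ∘ₗ inl = LinearMap.id
  snd_inl : snd ∘ₗ inl = 0
  inl_fst_add_inr_snd : inl ∘ₗ fst + inr ∘ₗ snd = LinearMap.id
  fst_mem : ∀ z ∈ C.lattice, fst z ∈ A.lattice
  snd_mem : ∀ z ∈ C.lattice, snd z ∈ B.lattice
  inl_mem : ∀ x ∈ A.lattice, inl x ∈ C.lattice
  herm_eq : ∀ γ z z', C.herm γ z z' =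
    A.herm γ (fst z) (fst z') + (t : ℂ) * B.herm γ (snd z) (snd z')

variable {C : RigidAdelicSpace.{u, v₁} K} {A : RigidAdelicSpace.{u, v₂} K}
  {B : RigidAdelicSpace.{u, v₃} K} {t : ℝ}

namespace OrthogonalSum

theorem isContraction_snd (h : OrthogonalSum C A B t) : IsContraction C B h.snd t where
  map_mem := h.snd_mem
  posSemidef γ ι _ z := by
    convert A.gram_posSemidef γ (fun i => h.fst (z i))
    ext i j
    simp [gram, h.herm_eq]

theorem isContraction_fst (h : OrthogonalSum C A B t) (ht : 0 ≤ t) :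
    IsContraction C A h.fst 1 where
  map_mem := h.fst_mem
  posSemidef γ ι _ z := by
    convert (B.gram_posSemidef γ (fun i => h.snd (z i))).smul
      (show (0 : ℂ) ≤ (t : ℂ) by exact_mod_cast ht)
    ext i j
    simp [gram, h.herm_eq]

theorem isContraction_inl (h : OrthogonalSum C A B t) : IsContraction A C h.inl 1 where
  map_mem := h.inl_mem
  posSemidef γ ι _ x := by
    convert Matrix.PosSemidef.zero
    ext i j
    have h1 : ∀ x, h.fst (h.inl x) = x := LinearMap.congr_fun h.fst_inl
    have h2 : ∀ x, h.snd (h.inl x) = 0 := LinearMap.congr_fun h.snd_inl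
    simp [gram, h.herm_eq, h1, h2]

theorem inl_injective (h : OrthogonalSum C A B t) : Function.Injective h.inl :=
  Function.LeftInverse.injective (g := h.fst) (LinearMap.congr_fun h.fst_inl)

/-- If `t` is so large that the second summand has the larger minimal height, the minimal height of
an orthogonal sum is that of the first summand. -/
theorem minHeight_eq (h : OrthogonalSum C A B t) [Nontrivial A.carrier] (ht : 0 < t)
    (hm : A.minHeight ≤ Real.sqrt t * B.minHeight) : C.minHeight = A.minHeight := by
  have : Nontrivial C.carrier := h.inl_injective.nontrivial
  apply le_antisymm
  · refine A.le_minHeight C.minHeight_nonneg fun W => ?_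
    have h1 := h.isContraction_inl.height_map_le one_pos W (by
      rw [LinearMap.ker_eq_bot.mpr h.inl_injective, inf_bot_eq])
    rw [Real.sqrt_one, one_pow, one_mul] at h1
    rw [← finrank_map_add_finrank_inf_ker h.inl W, LinearMap.ker_eq_bot.mpr h.inl_injective,
      inf_bot_eq, finrank_bot, add_zero]
    exact (C.minHeight_pow_le_height _).trans h1
  · refine C.le_minHeight A.minHeight_nonneg fun W => ?_
    set W₁ := W ⊓ LinearMap.ker h.snd with hW₁
    have h0 : W₁ ⊓ LinearMap.ker h.fst = ⊥ := by
      refine (Submodule.eq_bot_iff _).mpr fun z hz => ?_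
      have hz1 : h.fst z = 0 := hz.2
      have hz2 : h.snd z = 0 := hz.1.2
      have := LinearMap.congr_fun h.inl_fst_add_inr_snd z
      simpa [hz1, hz2] using this.symm
    have h1 := (h.isContraction_fst ht.le).height_map_le one_pos W₁ h0
    rw [Real.sqrt_one, one_pow, one_mul] at h1
    have h2 := h.isContraction_snd.height_mul_height_le ht W
    have h3 : Module.finrank K (W₁.map h.fst) = Module.finrank K W₁ := by
      rw [← finrank_map_add_finrank_inf_ker h.fst W₁, h0, finrank_bot, add_zero]
    have h4 := (A.minHeight_pow_le_height _).trans h1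
    rw [h3] at h4
    have h5 := B.minHeight_pow_le_height (W.map h.snd)
    rw [← finrank_map_add_finrank_inf_ker h.snd W, add_comm, pow_add]
    refine le_trans (mul_le_mul h4 ?_ (pow_nonneg A.minHeight_nonneg _) (height_nonneg _)) h2
    calc _ ≤ (Real.sqrt t * B.minHeight) ^ _ := pow_le_pow_left₀ A.minHeight_nonneg hm _
      _ = _ := mul_pow _ _ _
      _ ≤ _ := mul_le_mul_of_nonneg_left h5 (by positivity)

theorem rTensor_mem {A : RigidAdelicSpace.{u, v₂} K} {B : RigidAdelicSpace.{u, v₃} K}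
    {F : RigidAdelicSpace.{u, v} K} {f : A.carrier →ₗ[K] B.carrier}
    (hf : ∀ x ∈ A.lattice, f x ∈ B.lattice) :
    ∀ z ∈ (A.tensor F).lattice, f.rTensor F.carrier z ∈ (B.tensor F).lattice := by
  intro z hz
  have h : (A.tensor F).lattice ≤
      (B.tensor F).lattice.comap ((f.rTensor F.carrier).restrictScalars (𝓞 K)) := by
    refine Submodule.span_le.mpr ?_
    rintro _ ⟨x, hx, y, hy, rfl⟩
    exact Submodule.subset_span ⟨f x, hf x hx, y, hy, rfl⟩
  exact h hz

/-- Orthogonal sums are compatible with tensor products. -/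
noncomputable def tensor (h : OrthogonalSum C A B t) (F : RigidAdelicSpace.{u, v} K) :
    OrthogonalSum (C.tensor F) (A.tensor F) (B.tensor F) t where
  fst := h.fst.rTensor F.carrier
  snd := h.snd.rTensor F.carrier
  inl := h.inl.rTensor F.carrier
  inr := h.inr.rTensor F.carrier
  fst_inl := by
    change h.fst.rTensor F.carrier ∘ₗ h.inl.rTensor F.carrier = LinearMap.id
    rw [← LinearMap.rTensor_comp, h.fst_inl, LinearMap.rTensor_id]
  snd_inl := by
    change h.snd.rTensor F.carrier ∘ₗ h.inl.rTensor F.carrier = 0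
    rw [← LinearMap.rTensor_comp, h.snd_inl, LinearMap.rTensor_zero]
  inl_fst_add_inr_snd := by
    change h.inl.rTensor F.carrier ∘ₗ h.fst.rTensor F.carrier +
      h.inr.rTensor F.carrier ∘ₗ h.snd.rTensor F.carrier = LinearMap.id
    rw [← LinearMap.rTensor_comp, ← LinearMap.rTensor_comp, ← LinearMap.rTensor_add,
      h.inl_fst_add_inr_snd, LinearMap.rTensor_id]
  fst_mem := rTensor_mem h.fst_mem
  snd_mem := rTensor_mem h.snd_mem
  inl_mem := rTensor_mem h.inl_mem
  herm_eq γ := by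
    have key : ∀ z z' : C.carrier ⊗[K] F.carrier, tensorForm (C.herm γ) (F.herm γ) z z' =
        tensorForm (A.herm γ) (F.herm γ) (h.fst.rTensor F.carrier z) (h.fst.rTensor F.carrier z') +
          (t : ℂ) * tensorForm (B.herm γ) (F.herm γ) (h.snd.rTensor F.carrier z)
            (h.snd.rTensor F.carrier z') := by
      intro z z'
      induction z using TensorProduct.induction_on with
      | zero => simp
      | add x y hx hy => simp only [map_add, LinearMap.add_apply, hx, hy]; ring
      | tmul x y =>
        induction z' using TensorProduct.induction_on with
        | zero => simp
        | add x' y' hx hy => simp only [map_add, hx, hy]; ring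
        | tmul x' y' =>
          simp only [LinearMap.rTensor_tmul, tensorForm_tmul, h.herm_eq]
          ring
    exact key

end OrthogonalSum
end OrthogonalSum

/-! ### Dual forms and sums of forms -/

section Forms

variable {K : Type*} [Field K] {E : Type*} [AddCommGroup E] [Module K E] {γ : K →+* ℂ}

/-- The orthogonal sum of a sesquilinear form and of `t` times another one. -/
noncomputable def sumForm {E' : Type*} [AddCommGroup E'] [Module K E']
    (h : E →ₛₗ[(starRingEnd ℂ).comp γ] E →ₛₗ[γ] ℂ)
    (k : E' →ₛₗ[(starRingEnd ℂ).comp γ] E' →ₛₗ[γ] ℂ) (t : ℂ) :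
    (E × E') →ₛₗ[(starRingEnd ℂ).comp γ] (E × E') →ₛₗ[γ] ℂ :=
  LinearMap.mk₂'ₛₗ _ _
    (fun x y => h x.1 y.1 + t * k x.2 y.2)
    (fun _ _ _ => by
      simp only [Prod.fst_add, Prod.snd_add, map_add, LinearMap.add_apply]; ring)
    (fun _ _ _ => by
      simp only [Prod.smul_fst, Prod.smul_snd, LinearMap.map_smulₛₗ, LinearMap.smul_apply,
        smul_eq_mul]
      ring)
    (fun _ _ _ => by simp only [Prod.fst_add, Prod.snd_add, map_add]; ring)
    (fun _ _ _ => by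
      simp only [Prod.smul_fst, Prod.smul_snd, LinearMap.map_smulₛₗ, smul_eq_mul]
      ring)

theorem sumForm_apply {E' : Type*} [AddCommGroup E'] [Module K E']
    (h : E →ₛₗ[(starRingEnd ℂ).comp γ] E →ₛₗ[γ] ℂ)
    (k : E' →ₛₗ[(starRingEnd ℂ).comp γ] E' →ₛₗ[γ] ℂ) (t : ℂ) (x y : E × E') :
    sumForm h k t x y = h x.1 y.1 + t * k x.2 y.2 := rfl

theorem gram_sumForm {E' : Type*} [AddCommGroup E'] [Module K E']
    (h : E →ₛₗ[(starRingEnd ℂ).comp γ] E →ₛₗ[γ] ℂ)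
    (k : E' →ₛₗ[(starRingEnd ℂ).comp γ] E' →ₛₗ[γ] ℂ) (t : ℂ) {ι κ : Type*}
    (b : Module.Basis ι K E) (c : Module.Basis κ K E') :
    gram (sumForm h k t) (b.prod c) = Matrix.fromBlocks (gram h b) 0 0 (t • gram k c) := by
  ext (i | i) (j | j) <;> simp [gram, sumForm_apply]

theorem posDef_fromBlocks_diagonal {m n : Type*} [Fintype m] [Fintype n] {P : Matrix m m ℂ}
    {Q : Matrix n n ℂ} (hP : P.PosDef) (hQ : Q.PosDef) : (Matrix.fromBlocks P 0 0 Q).PosDef := by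
  refine .of_dotProduct_mulVec_pos ?_ fun {x} hx => ?_
  · rw [Matrix.isHermitian_fromBlocks_iff]
    exact ⟨hP.isHermitian, by simp, by simp, hQ.isHermitian⟩
  · have h1 : star x ⬝ᵥ (Matrix.fromBlocks P 0 0 Q).mulVec x =
        star (x ∘ Sum.inl) ⬝ᵥ P.mulVec (x ∘ Sum.inl) +
          star (x ∘ Sum.inr) ⬝ᵥ Q.mulVec (x ∘ Sum.inr) := by
      rw [Matrix.fromBlocks_mulVec]
      simp [dotProduct, Fintype.sum_sum_type]
    rw [h1]
    by_cases h2 : x ∘ Sum.inl = 0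
    · have h3 : x ∘ Sum.inr ≠ 0 := fun h3 => hx (funext fun i => by
        rcases i with i | i
        · exact congrFun h2 i
        · exact congrFun h3 i)
      exact add_pos_of_nonneg_of_pos (hP.posSemidef.dotProduct_mulVec_nonneg _)
        (hQ.dotProduct_mulVec_pos h3)
    · exact add_pos_of_pos_of_nonneg (hP.dotProduct_mulVec_pos h2)
        (hQ.posSemidef.dotProduct_mulVec_nonneg _)

theorem dualForm_eq_dotProduct (h : E →ₛₗ[(starRingEnd ℂ).comp γ] E →ₛₗ[γ] ℂ) {ι : Type*}
    [Fintype ι] [DecidableEq ι] (b : Module.Basis ι K E) (φ ψ : Module.Dual K E) :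
    dualForm h b φ ψ =
      (fun i => γ (ψ (b i))) ⬝ᵥ ((gram h b)⁻¹.mulVec (star fun j => γ (φ (b j)))) := by
  simp only [dualForm_apply, dotProduct, Matrix.mulVec, Finset.mul_sum, Pi.star_apply,
    starRingEnd_apply]
  exact Finset.sum_congr rfl fun i _ => Finset.sum_congr rfl fun j _ => by ring

/-- The dual form does not depend on the basis used to compute it. -/
theorem dualForm_eq_dualForm (h : E →ₛₗ[(starRingEnd ℂ).comp γ] E →ₛₗ[γ] ℂ) {ι κ : Type*}
    [Fintype ι] [DecidableEq ι] [Fintype κ] [DecidableEq κ] (b : Module.Basis ι K E)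
    (c : Module.Basis κ K E) (hb : IsUnit (gram h b).det) (φ ψ : Module.Dual K E) :
    dualForm h b φ ψ = dualForm h c φ ψ := by
  set M := (b.toMatrix c).map γ with hM
  set N := (c.toMatrix b).map γ with hN
  have hMN : M * N = 1 := by
    rw [hM, hN, ← Matrix.map_mul, b.toMatrix_mul_toMatrix_flip]; simp
  have hNM : N * M = 1 := by
    rw [hM, hN, ← Matrix.map_mul, c.toMatrix_mul_toMatrix_flip]; simp
  have hc : ⇑c = fun j => ∑ i, b.toMatrix c i j • b i := by
    funext j
    exact (b.sum_toMatrix_smul_self c j).symm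
  have hg : gram h c = M.conjTranspose * gram h b * M := by
    conv_lhs => rw [hc]
    exact gram_change h b (b.toMatrix c)
  have hinv : (gram h c)⁻¹ = N * (gram h b)⁻¹ * N.conjTranspose := by
    refine Matrix.inv_eq_right_inv ?_
    rw [hg]
    calc _ = M.conjTranspose * gram h b * (M * N) * (gram h b)⁻¹ * N.conjTranspose := by
          simp only [Matrix.mul_assoc]
      _ = M.conjTranspose * (gram h b * (gram h b)⁻¹) * N.conjTranspose := by
          rw [hMN, Matrix.mul_one]
          simp only [Matrix.mul_assoc]
      _ = 1 := by
          rw [Matrix.mul_nonsing_inv _ hb, Matrix.mul_one, ← Matrix.conjTranspose_mul, hNM,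
            Matrix.conjTranspose_one]
  have hv : ∀ χ : Module.Dual K E,
      (fun j => γ (χ (c j))) = Matrix.vecMul (fun i => γ (χ (b i))) M := by
    intro χ
    funext j
    rw [← b.sum_toMatrix_smul_self c j, map_sum, map_sum]
    exact Finset.sum_congr rfl fun i _ => by simp [hM, mul_comm]
  rw [dualForm_eq_dotProduct, dualForm_eq_dotProduct, hinv, hv φ, hv ψ, Matrix.star_vecMul,
    ← Matrix.dotProduct_mulVec, Matrix.mulVec_mulVec, Matrix.mulVec_mulVec]
  congr 2
  calc _ = (1 : Matrix ι ι ℂ) * (gram h b)⁻¹ * (1 : Matrix ι ι ℂ).conjTranspose := by simp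
    _ = _ := by
      rw [← hMN, Matrix.conjTranspose_mul]
      simp only [Matrix.mul_assoc]

theorem dualForm_congr {E' : Type*} [AddCommGroup E'] [Module K E'] {γ' : K →+* ℂ}
    {h : E →ₛₗ[(starRingEnd ℂ).comp γ] E →ₛₗ[γ] ℂ}
    {k : E' →ₛₗ[(starRingEnd ℂ).comp γ'] E' →ₛₗ[γ'] ℂ} {ι : Type*} [Fintype ι] [DecidableEq ι]
    {b : Module.Basis ι K E} {c : Module.Basis ι K E'} (hg : gram h b = gram k c)
    {φ ψ : Module.Dual K E} {φ' ψ' : Module.Dual K E'} (hφ : ∀ i, γ (φ (b i)) = γ' (φ' (c i)))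
    (hψ : ∀ i, γ (ψ (b i)) = γ' (ψ' (c i))) : dualForm h b φ ψ = dualForm k c φ' ψ' := by
  simp only [dualForm_apply, hg, hφ, hψ]

/-- Biduality of forms. -/
theorem dualForm_dualForm (h : E →ₛₗ[(starRingEnd ℂ).comp γ] E →ₛₗ[γ] ℂ) {ι : Type*} [Fintype ι]
    [DecidableEq ι] (b : Module.Basis ι K E) (hb : IsUnit (gram h b).det) (x y : E) :
    dualForm (dualForm h b) b.dualBasis (Module.Dual.eval K E x) (Module.Dual.eval K E y) =
      h x y := by
  rw [dualForm_apply, gram_dualForm, ← Matrix.transpose_nonsing_inv,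
    Matrix.nonsing_inv_nonsing_inv _ hb]
  conv_rhs => rw [← b.sum_repr x, ← b.sum_repr y]
  simp only [map_sum, LinearMap.sum_apply, LinearMap.map_smulₛₗ, LinearMap.smul_apply, smul_eq_mul,
    Finset.mul_sum, Matrix.transpose_apply, gram, Matrix.of_apply, RingHom.comp_apply,
    Module.Dual.eval_apply, Module.Basis.dualBasis_apply]
  refine Finset.sum_congr rfl fun i _ => Finset.sum_congr rfl fun j _ => ?_
  ring

/-- The dual of an orthogonal sum is the orthogonal sum of the duals, with inverse scaling. -/
theorem dualForm_sumForm {E' : Type*} [AddCommGroup E'] [Module K E']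
    (h : E →ₛₗ[(starRingEnd ℂ).comp γ] E →ₛₗ[γ] ℂ)
    (k : E' →ₛₗ[(starRingEnd ℂ).comp γ] E' →ₛₗ[γ] ℂ) {t : ℂ} (ht : t ≠ 0) {ι κ : Type*}
    [Fintype ι] [DecidableEq ι] [Fintype κ] [DecidableEq κ]
    (b : Module.Basis ι K E) (c : Module.Basis κ K E') (hb : IsUnit (gram h b).det)
    (hc : IsUnit (gram k c).det) (φ ψ : Module.Dual K (E × E')) :
    dualForm (sumForm h k t) (b.prod c) φ ψ =
      dualForm h b (φ ∘ₗ LinearMap.inl K E E') (ψ ∘ₗ LinearMap.inl K E E') +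
        t⁻¹ * dualForm k c (φ ∘ₗ LinearMap.inr K E E') (ψ ∘ₗ LinearMap.inr K E E') := by
  have hinv : (gram (sumForm h k t) (b.prod c))⁻¹ =
      Matrix.fromBlocks (gram h b)⁻¹ 0 0 (t⁻¹ • (gram k c)⁻¹) := by
    have h1 : (t • gram k c) * (t⁻¹ • (gram k c)⁻¹) = 1 := by
      rw [Matrix.smul_mul, Matrix.mul_smul, Matrix.mul_nonsing_inv _ hc, smul_smul,
        mul_inv_cancel₀ ht, one_smul]
    refine Matrix.inv_eq_right_inv ?_
    rw [gram_sumForm, Matrix.fromBlocks_multiply, Matrix.mul_nonsing_inv _ hb, h1]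
    simp
  rw [dualForm_apply, hinv, dualForm_apply, dualForm_apply]
  simp only [Fintype.sum_sum_type, Matrix.fromBlocks_apply₁₁, Matrix.fromBlocks_apply₁₂,
    Matrix.fromBlocks_apply₂₁, Matrix.fromBlocks_apply₂₂, Matrix.zero_apply, mul_zero, zero_mul,
    Finset.sum_const_zero, add_zero, zero_add, Matrix.smul_apply, smul_eq_mul, Finset.mul_sum,
    LinearMap.comp_apply, LinearMap.inl_apply,
    LinearMap.inr_apply, Module.Basis.prod_apply, Sum.elim_inl, Sum.elim_inr]
  congr 1
  exact Finset.sum_congr rfl fun i _ => Finset.sum_congr rfl fun j _ => by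
    simp only [Function.comp_apply, LinearMap.inr_apply]; ring

end Forms

/-! ### Direct sums and duals of rigid adelic spaces -/

section DirectSum

universe v₁ v₂

variable {K : Type u} [Field K] [NumberField K]

/-- The orthogonal direct sum of `A` and of the space `B` with its Hermitian forms multiplied by
`t`. -/
noncomputable def directSum (A : RigidAdelicSpace.{u, v₁} K) (B : RigidAdelicSpace.{u, v₂} K) (t : ℝ)
    (ht : 0 < t) : RigidAdelicSpace.{u, max v₁ v₂} K where
  carrier := A.carrier × B.carrier
  lattice := A.lattice.prod B.lattice
  isLattice := by
    constructor
    · exact A.isLattice.fg.prod B.isLattice.fg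
    · rw [eq_top_iff]
      rintro ⟨x, y⟩ -
      obtain ⟨a, ha, hax⟩ := exists_smul_mem A.lattice A.isLattice.span_eq_top x
      obtain ⟨b, hb, hby⟩ := exists_smul_mem B.lattice B.isLattice.span_eq_top y
      have hab : algebraMap (𝓞 K) K (a * b) ≠ 0 := by simpa using ⟨ha, hb⟩
      rw [← inv_smul_smul₀ hab (x, y), algebraMap_smul]
      refine Submodule.smul_mem _ _ (Submodule.subset_span ⟨?_, ?_⟩)
      · change (a * b) • x ∈ A.lattice
        rw [mul_comm, mul_smul]
        exact A.lattice.smul_mem b hax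
      · change (a * b) • y ∈ B.lattice
        rw [mul_smul]
        exact B.lattice.smul_mem a hby
  herm γ := sumForm (A.herm γ) (B.herm γ) t
  herm_symm γ x y := by
    simp only [sumForm_apply, map_add, map_mul, Complex.conj_ofReal]
    rw [A.herm_symm γ x.1 y.1, B.herm_symm γ x.2 y.2]
  herm_conjugate γ x y := by
    simp only [sumForm_apply, map_add, map_mul, Complex.conj_ofReal, A.herm_conjugate,
      B.herm_conjugate]
  herm_posDef γ n x hx := by
    refine posDef_gram_of_basis _
      ((Module.finBasis K A.carrier).prod (Module.finBasis K B.carrier)) ?_ x hx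
    rw [gram_sumForm]
    exact posDef_fromBlocks_diagonal
      (A.gram_posDef γ _ (Module.finBasis K A.carrier).linearIndependent) <|
      (B.gram_posDef γ _ (Module.finBasis K B.carrier).linearIndependent).smul
      (show (0 : ℂ) < (t : ℂ) by exact_mod_cast ht)

variable {A : RigidAdelicSpace.{u, v₁} K} {B : RigidAdelicSpace.{u, v₂} K} {t : ℝ} {ht : 0 < t}

/-- The direct sum as an orthogonal sum. -/
noncomputable def orthogonalSum (A : RigidAdelicSpace.{u, v₁} K) (B : RigidAdelicSpace.{u, v₂} K)
    (t : ℝ) (ht : 0 < t) : OrthogonalSum (directSum A B t ht) A B t where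
  fst := LinearMap.fst K A.carrier B.carrier
  snd := LinearMap.snd K A.carrier B.carrier
  inl := LinearMap.inl K A.carrier B.carrier
  inr := LinearMap.inr K A.carrier B.carrier
  fst_inl := LinearMap.fst_comp_inl _ _ _
  snd_inl := LinearMap.snd_comp_inl _ _ _
  inl_fst_add_inr_snd := LinearMap.ext fun z => by
    change LinearMap.inl K A.carrier B.carrier z.1 + LinearMap.inr K A.carrier B.carrier z.2 = z
    exact Prod.ext (by simp) (by simp)
  fst_mem _ hz := hz.1
  snd_mem _ hz := hz.2
  inl_mem _ hx := ⟨hx, B.lattice.zero_mem⟩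
  herm_eq _ _ _ := rfl

/-- If all the sums of `A` and of rescalings of some `B` satisfy the multiplicativity of minimal
heights, so does `A`. -/
theorem minHeight_tensor_of_directSum (A : RigidAdelicSpace.{u, v₁} K)
    (B : RigidAdelicSpace.{u, v₂} K) (F : RigidAdelicSpace.{u, v} K) [Nontrivial A.carrier]
    [Nontrivial B.carrier] [Nontrivial F.carrier]
    (H : ∀ t (ht : 0 < t), ((directSum A B t ht).tensor F).minHeight =
      (directSum A B t ht).minHeight * F.minHeight) :
    (A.tensor F).minHeight = A.minHeight * F.minHeight := by
  have : Nontrivial (A.tensor F).carrier := inferInstanceAs (Nontrivial (A.carrier ⊗[K] F.carrier))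
  have : Nontrivial (B.tensor F).carrier := inferInstanceAs (Nontrivial (B.carrier ⊗[K] F.carrier))
  have hB := B.minHeight_pos
  have hBF := (B.tensor F).minHeight_pos
  -- with `t = r ^ 2` the second summand is irrelevant for the minimal heights of the sum and of its
  -- tensor product with `F`
  set r : ℝ := max 1 (max (A.minHeight / B.minHeight)
    ((A.tensor F).minHeight / (B.tensor F).minHeight)) with hr
  have hr0 : 0 < r := lt_max_of_lt_left one_pos
  have ht : 0 < r ^ 2 := by positivity
  have h1 := (orthogonalSum A B (r ^ 2) ht).minHeight_eq ht (by
    rw [Real.sqrt_sq hr0.le, ← div_le_iff₀ hB]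
    exact (le_max_left _ _).trans (le_max_right _ _))
  have h2 := ((orthogonalSum A B (r ^ 2) ht).tensor F).minHeight_eq ht (by
    rw [Real.sqrt_sq hr0.le, ← div_le_iff₀ hBF]
    exact (le_max_right _ _).trans (le_max_right _ _))
  rw [← h1, ← h2]
  exact H _ ht

theorem dual_herm (A : RigidAdelicSpace.{u, v} K) (γ : K →+* ℂ) {ι : Type*} [Fintype ι]
    [DecidableEq ι] (b : Module.Basis ι K A.carrier) (φ ψ : Module.Dual K A.carrier) :
    A.dual.herm γ φ ψ = dualForm (A.herm γ) b φ ψ :=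
  dualForm_eq_dualForm _ _ _ ((Matrix.isUnit_iff_isUnit_det _).mp
    (A.gram_posDef γ _ (Module.finBasis K A.carrier).linearIndependent).isUnit) _ _

theorem dual_directSum_herm (γ : K →+* ℂ) (φ ψ : Module.Dual K A.carrier)
    (φ' ψ' : Module.Dual K B.carrier) :
    (directSum A B t ht).dual.herm γ (LinearMap.coprod φ φ') (LinearMap.coprod ψ ψ') =
      A.dual.herm γ φ ψ + (t : ℂ)⁻¹ * B.dual.herm γ φ' ψ' := by
  have h := (dual_herm (directSum A B t ht) γ
    ((Module.finBasis K A.carrier).prod (Module.finBasis K B.carrier)) (LinearMap.coprod φ φ')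
    (LinearMap.coprod ψ ψ')).trans (dualForm_sumForm (A.herm γ) (B.herm γ)
      (by exact_mod_cast ht.ne') _ _
      ((Matrix.isUnit_iff_isUnit_det _).mp
        (A.gram_posDef γ _ (Module.finBasis K A.carrier).linearIndependent).isUnit)
      ((Matrix.isUnit_iff_isUnit_det _).mp
        (B.gram_posDef γ _ (Module.finBasis K B.carrier).linearIndependent).isUnit) _ _)
  rw [LinearMap.coprod_inl, LinearMap.coprod_inl, LinearMap.coprod_inr, LinearMap.coprod_inr] at h
  exact h

/-- The bidual form is the original form. -/
theorem dual_dual_herm (A : RigidAdelicSpace.{u, v} K) (γ : K →+* ℂ) (x y : A.carrier) :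
    A.dual.dual.herm γ (Module.Dual.eval K A.carrier x) (Module.Dual.eval K A.carrier y) =
      A.herm γ x y := by
  have hu := (Matrix.isUnit_iff_isUnit_det _).mp
    (A.gram_posDef γ _ (Module.finBasis K A.carrier).linearIndependent).isUnit
  exact (dual_herm A.dual γ (Module.finBasis K A.carrier).dualBasis _ _).trans
    (dualForm_dualForm (A.herm γ) _ hu x y)

theorem herm_smul_smul (A : RigidAdelicSpace.{u, v} K) (γ : K →+* ℂ) {ε : K} (hε : ε = 1 ∨ ε = -1)
    (x y : A.carrier) : A.herm γ (ε • x) (ε • y) = A.herm γ x y := by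
  rcases hε with rfl | rfl <;> simp

/-- Lattices over a Dedekind domain are reflexive. -/
theorem mem_lattice_of_forall_dual (A : RigidAdelicSpace.{u, v} K) {x : A.carrier}
    (hx : ∀ ψ ∈ A.dualLattice, ∃ a : 𝓞 K, ψ x = algebraMap (𝓞 K) K a) : x ∈ A.lattice := by
  classical
  obtain ⟨ι, _, b, 𝔞, hb⟩ := exists_isPseudoBasis A.lattice
  refine (hb.mem_iff x).mpr fun i => ?_
  rw [← inv_inv (𝔞 i), FractionalIdeal.mem_inv_iff (inv_ne_zero (hb.ne_zero i))]
  intro α hα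
  obtain ⟨a, ha⟩ := hx (α • b.coord i) fun y hy => by
    have := (FractionalIdeal.mem_inv_iff (hb.ne_zero i)).mp hα _ ((hb.mem_iff y).mp hy i)
    obtain ⟨a, ha⟩ := (FractionalIdeal.mem_one_iff _).mp this
    exact ⟨a, by rw [ha]; simp⟩
  refine (FractionalIdeal.mem_one_iff _).mpr ⟨a, ?_⟩
  rw [← ha]
  simp [mul_comm]

/-- The lattice of `E × Eᵛ` is its own dual under a pairing `((x, φ), (y, ψ)) ↦ φ y + g (ψ x)`, if
`g` preserves integrality. -/
theorem forall_pairing_integral_iff (A : RigidAdelicSpace.{u, v} K) {g : K → K} (hg0 : g 0 = 0)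
    (hg : ∀ k, (∃ a : 𝓞 K, g k = algebraMap (𝓞 K) K a) ↔ ∃ a : 𝓞 K, k = algebraMap (𝓞 K) K a)
    (x : A.carrier) (φ : Module.Dual K A.carrier) :
    (∀ y ∈ A.lattice, ∀ ψ ∈ A.dualLattice, ∃ a : 𝓞 K, φ y + g (ψ x) = algebraMap (𝓞 K) K a) ↔
      x ∈ A.lattice ∧ φ ∈ A.dualLattice := by
  constructor
  · intro h
    refine ⟨A.mem_lattice_of_forall_dual fun ψ hψ => (hg _).mp ?_, fun y hy => ?_⟩
    · simpa using h 0 A.lattice.zero_mem ψ hψ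
    · simpa [hg0] using h y hy 0 A.dualLattice.zero_mem
  · rintro ⟨hx, hφ⟩ y hy ψ hψ
    obtain ⟨a, ha⟩ := hφ y hy
    obtain ⟨b, hb⟩ := (hg _).mpr (hψ x hx)
    exact ⟨a + b, by rw [ha, hb, map_add]⟩

end DirectSum

/-! ### Hyperbolic spaces -/

section Hyperbolic

variable {K : Type u} [Field K]

/-- The map from `V × Vᵛ` to its dual with bilinear form
`((x, φ), (y, ψ)) ↦ φ y + ε * ψ x`. -/
noncomputable def swap (V : Type*) [AddCommGroup V] [Module K V] (ε : K) :
    (V × Module.Dual K V) →ₗ[K] Module.Dual K (V × Module.Dual K V) where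
  toFun z := LinearMap.coprod z.2 (ε • Module.Dual.eval K V z.1)
  map_add' z z' := by
    ext <;> simp
  map_smul' a z := by
    ext <;> simp [mul_left_comm]

theorem swap_apply {V : Type*} [AddCommGroup V] [Module K V] (ε : K)
    (z z' : V × Module.Dual K V) : swap V ε z z' = z.2 z'.1 + ε * z'.2 z.1 := by
  simp [swap]

theorem swap_bijective (V : Type*) [AddCommGroup V] [Module K V] [FiniteDimensional K V] {ε : K}
    (hε : ε ≠ 0) : Function.Bijective (swap V ε) := by
  constructor
  · rw [← LinearMap.ker_eq_bot, LinearMap.ker_eq_bot']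
    rintro ⟨x, φ⟩ h
    have hφ : φ = 0 := LinearMap.ext fun y => by
      simpa [swap_apply] using LinearMap.congr_fun h (y, 0)
    have hx : x = 0 := (Module.forall_dual_apply_eq_zero_iff K x).mp fun ψ => by
      simpa [swap_apply, hε] using LinearMap.congr_fun h (0, ψ)
    rw [hφ, hx]; rfl
  · intro Φ
    obtain ⟨x, hx⟩ := (Module.bijective_dual_eval K V).2
      (ε⁻¹ • (Φ ∘ₗ LinearMap.inr K V (Module.Dual K V)))
    refine ⟨(x, Φ ∘ₗ LinearMap.inl K V (Module.Dual K V)), ?_⟩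
    refine LinearMap.ext fun z => ?_
    have h1 : z.2 x = ε⁻¹ * Φ (0, z.2) := by
      simpa using LinearMap.congr_fun hx z.2
    rw [swap_apply, h1, mul_inv_cancel_left₀ hε]
    simp [← map_add]

variable [NumberField K]

/-- A bijection between the lattices which multiplies the forms by a constant is a similarity. -/
theorem isSimilarity_of_bijective {A : RigidAdelicSpace.{u, v} K} {B : RigidAdelicSpace.{u, w} K}
    {σ : A.carrier →ₗ[K] B.carrier} (hσ : Function.Bijective σ)
    (hL : ∀ x, σ x ∈ B.lattice ↔ x ∈ A.lattice) {c : ℝ} (hc : 0 < c)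
    (hh : ∀ γ x, (B.herm γ (σ x) (σ x)).re = c * (A.herm γ x x).re) : IsSimilarity σ := by
  refine ⟨fun w => ⟨Real.sqrt c, Real.sqrt_pos.mpr hc, fun x => ?_⟩, fun _ => 1,
    fun _ => one_pos, by simp, fun p x => ?_⟩
  · rw [infNorm, infNorm, hh, Real.sqrt_mul hc.le]
  · rw [one_mul, finNorm, finNorm]
    congr 1
    ext r
    refine exists_congr fun α => and_congr_left fun _ => exists_congr fun s => and_congr_right
      fun _ => ?_
    constructor
    · rintro ⟨y, hy, h⟩
      obtain ⟨z, rfl⟩ := hσ.2 y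
      refine ⟨z, (hL z).mp hy, hσ.1 ?_⟩
      rw [LinearMap.map_smul_of_tower, h, map_smul]
    · rintro ⟨y, hy, h⟩
      refine ⟨σ y, (hL y).mpr hy, ?_⟩
      rw [← LinearMap.map_smul_of_tower, h, map_smul]

/-- The sum of a space and of any rescaling of its dual is similar to its own dual. -/
theorem isSimilarity_swap (A : RigidAdelicSpace.{u, v} K) {t : ℝ} (ht : 0 < t) {ε : K}
    (hε : ε = 1 ∨ ε = -1) :
    IsSimilarity (A := directSum A A.dual t ht) (B := (directSum A A.dual t ht).dual)
      (swap A.carrier ε) := by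
  have hε0 : ε ≠ 0 := by rcases hε with rfl | rfl <;> simp
  refine isSimilarity_of_bijective (swap_bijective A.carrier hε0) ?_ (inv_pos.mpr ht) ?_
  · rintro ⟨x, φ⟩
    have h := A.forall_pairing_integral_iff (g := fun k => ε * k) (mul_zero ε) (fun k => by
      rcases hε with rfl | rfl
      · simp
      · refine ⟨fun ⟨a, ha⟩ => ⟨-a, ?_⟩, fun ⟨a, ha⟩ => ⟨-a, ?_⟩⟩
        · rw [map_neg, ← ha]; ring
        · rw [map_neg, ← ha]; ring) x φ
    refine Iff.trans ⟨fun H y hy ψ hψ => ?_, fun H z hz => ?_⟩ h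
    · obtain ⟨a, ha⟩ := H (y, ψ) ⟨hy, hψ⟩
      exact ⟨a, (swap_apply ε (x, φ) (y, ψ)).symm.trans ha⟩
    · obtain ⟨a, ha⟩ := H z.1 hz.1 z.2 hz.2
      exact ⟨a, (swap_apply ε (x, φ) z).trans ha⟩
  · rintro γ ⟨x, φ⟩
    have h1 := (dual_directSum_herm (A := A) (B := A.dual) (ht := ht) γ φ φ
      (ε • Module.Dual.eval K A.carrier x) (ε • Module.Dual.eval K A.carrier x)).trans
        (congrArg (fun r => A.dual.herm γ φ φ + (t : ℂ)⁻¹ * r)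
          ((A.dual.dual.herm_smul_smul γ hε _ _).trans (dual_dual_herm A γ x x)))
    have h2 : A.dual.herm γ φ φ + (t : ℂ)⁻¹ * A.herm γ x x =
        ((t⁻¹ : ℝ) : ℂ) * (A.herm γ x x + (t : ℂ) * A.dual.herm γ φ φ) := by
      have ht' : (t : ℂ) ≠ 0 := by exact_mod_cast ht.ne'
      push_cast
      field_simp
      ring
    exact (congrArg Complex.re (h1.trans h2)).trans (Complex.re_ofReal_mul _ _)

theorem isOrthogonal_directSum_dual (A : RigidAdelicSpace.{u, v} K) {t : ℝ} (ht : 0 < t) :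
    (directSum A A.dual t ht).IsOrthogonal := by
  refine ⟨swap A.carrier 1, isSimilarity_swap A ht (Or.inl rfl), fun x y => ?_⟩
  refine (swap_apply 1 y x).trans (Eq.trans ?_ (swap_apply 1 x y).symm)
  ring

theorem isSymplectic_directSum_dual (A : RigidAdelicSpace.{u, v} K) {t : ℝ} (ht : 0 < t) :
    (directSum A A.dual t ht).IsSymplectic := by
  refine ⟨swap A.carrier (-1), isSimilarity_swap A ht (Or.inr rfl), fun x => ?_⟩
  refine (swap_apply (-1) x x).trans ?_
  ring

end Hyperbolic

/-! ### Conjugates -/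

section Conjugate

variable {K : Type u} [Field K] [NumberField K] [IsCMField K]

/-- The linear form on the conjugate space obtained by conjugating the values of a linear form. -/
noncomputable def conjDual {A : RigidAdelicSpace.{u, v} K} (ψ : Module.Dual K A.carrier) :
    Module.Dual K A.ConjCarrier where
  toFun z := IsCMField.complexConj K (ψ (A.toConj.symm z))
  map_add' z z' := by simp
  map_smul' a z := by simp [conj_smul]

theorem conjDual_apply {A : RigidAdelicSpace.{u, v} K} (ψ : Module.Dual K A.carrier)
    (z : A.ConjCarrier) : conjDual ψ z = IsCMField.complexConj K (ψ (A.toConj.symm z)) := rfl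

/-- A basis of a space, as a basis of the conjugate space. -/
noncomputable def conjBasis {A : RigidAdelicSpace.{u, v} K} {ι : Type*} [Fintype ι]
    (b : Module.Basis ι K A.carrier) : Module.Basis ι K A.ConjCarrier :=
  Module.Basis.mk (v := fun i => A.toConj (b i))
    (by
      rw [Fintype.linearIndependent_iff]
      intro g hg i
      have := Fintype.linearIndependent_iff.mp b.linearIndependent
        (fun i => IsCMField.complexConj K (g i))
        (by simpa [conj_smul] using congrArg A.toConj.symm hg) i
      simpa using this)
    (by
      rintro x -
      have hx : x = ∑ i, IsCMField.complexConj K (b.repr (A.toConj.symm x) i) • A.toConj (b i) := by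
        rw [← A.toConj.apply_symm_apply x]
        conv_lhs => rw [← b.sum_repr (A.toConj.symm x)]
        simp only [conj_smul, IsCMField.complexConj_apply_apply, AddEquiv.symm_apply_apply, map_sum]
      rw [hx]
      exact Submodule.sum_mem _ fun i _ => Submodule.smul_mem _ _ (Submodule.subset_span ⟨i, rfl⟩))

theorem conjBasis_apply {A : RigidAdelicSpace.{u, v} K} {ι : Type*} [Fintype ι]
    (b : Module.Basis ι K A.carrier) (i : ι) : conjBasis b i = A.toConj (b i) := by
  simp [conjBasis]

/-- The dual of the conjugate is the conjugate of the dual, as far as forms are concerned. -/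
theorem dual_conjugate_herm (A : RigidAdelicSpace.{u, v} K) (γ : K →+* ℂ)
    (φ ψ : Module.Dual K A.carrier) :
    A.conjugate.dual.herm γ (conjDual φ) (conjDual ψ) =
      A.dual.herm (ComplexEmbedding.conjugate γ) φ ψ := by
  have h : ∀ (χ : Module.Dual K A.carrier) i,
      γ (conjDual χ (conjBasis (Module.finBasis K A.carrier) i)) =
        ComplexEmbedding.conjugate γ (χ (Module.finBasis K A.carrier i)) := by
    intro χ i
    rw [conjBasis_apply, conjDual_apply, AddEquiv.symm_apply_apply]
    simp
  refine (dual_herm A.conjugate γ (conjBasis (Module.finBasis K A.carrier)) (conjDual φ)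
    (conjDual ψ)).trans (dualForm_congr ?_ (h φ) (h ψ))
  ext i j
  change A.herm (ComplexEmbedding.conjugate γ) (A.toConj.symm (conjBasis _ i))
    (A.toConj.symm (conjBasis _ j)) = _
  rw [conjBasis_apply, conjBasis_apply]
  rfl

/-- The linear form `(y, ψ) ↦ φ y + conj (ψ x)` on the product of `A` and its conjugate dual. -/
noncomputable def conjPairing (A : RigidAdelicSpace.{u, v} K) (x : A.carrier)
    (φ : Module.Dual K A.carrier) : Module.Dual K (A.carrier × A.dual.ConjCarrier) :=
  LinearMap.coprod φ (conjDual (A := A.dual) (Module.Dual.eval K A.carrier x))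

theorem conjPairing_apply (A : RigidAdelicSpace.{u, v} K) (x y : A.carrier)
    (φ ψ : Module.Dual K A.carrier) :
    conjPairing A x φ (y, A.dual.toConj ψ) = φ y + IsCMField.complexConj K (ψ x) := rfl

theorem conjPairing_ext {A : RigidAdelicSpace.{u, v} K}
    {Φ Ψ : Module.Dual K (A.carrier × A.dual.ConjCarrier)}
    (h : ∀ (y : A.carrier) (ψ : Module.Dual K A.carrier),
      Φ (y, A.dual.toConj ψ) = Ψ (y, A.dual.toConj ψ)) : Φ = Ψ :=
  LinearMap.ext fun z => h z.1 (A.dual.toConj.symm z.2)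

theorem conjPairing_add (A : RigidAdelicSpace.{u, v} K) (x x' : A.carrier)
    (φ φ' : Module.Dual K A.carrier) :
    conjPairing A (x + x') (φ + φ') = conjPairing A x φ + conjPairing A x' φ' :=
  conjPairing_ext fun y ψ => by
    simp only [conjPairing_apply, LinearMap.add_apply, map_add]
    ring

theorem conjPairing_smul (A : RigidAdelicSpace.{u, v} K) (a : K) (x : A.carrier)
    (φ : Module.Dual K A.carrier) :
    conjPairing A (a • x) (IsCMField.complexConj K a • φ) =
      IsCMField.complexConj K a • conjPairing A x φ :=
  conjPairing_ext fun y ψ => by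
    simp only [conjPairing_apply, LinearMap.smul_apply, map_smul, smul_eq_mul, map_mul]
    ring

/-- The map from the sum of `A` and its conjugate dual to the conjugate dual of this sum, with
Hermitian form `((x, φ), (y, ψ)) ↦ φ y + conj (ψ x)`. -/
noncomputable def conjSwap (A : RigidAdelicSpace.{u, v} K) {t : ℝ} (ht : 0 < t) :
    (directSum A A.dual.conjugate t ht).carrier →ₗ[K]
      (directSum A A.dual.conjugate t ht).dual.conjugate.carrier where
  toFun z := (directSum A A.dual.conjugate t ht).dual.toConj
    (conjPairing A z.1 (A.dual.toConj.symm z.2))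
  map_add' z z' := conjPairing_add A z.1 z'.1 _ _
  map_smul' a z := conjPairing_smul A a z.1 _

theorem conjForm_conjSwap (A : RigidAdelicSpace.{u, v} K) {t : ℝ} (ht : 0 < t)
    (x y : A.carrier) (φ ψ : Module.Dual K A.carrier) :
    conjForm (conjSwap A ht) (x, A.dual.toConj φ) (y, A.dual.toConj ψ) =
      φ y + IsCMField.complexConj K (ψ x) := rfl

theorem conjPairing_bijective (A : RigidAdelicSpace.{u, v} K) :
    Function.Bijective fun z : A.carrier × Module.Dual K A.carrier => conjPairing A z.1 z.2 := by
  constructor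
  · rintro ⟨x, φ⟩ ⟨x', φ'⟩ h
    have h' : ∀ (y : A.carrier) (ψ : Module.Dual K A.carrier),
        φ y + IsCMField.complexConj K (ψ x) = φ' y + IsCMField.complexConj K (ψ x') := fun y ψ =>
      LinearMap.congr_fun h (y, A.dual.toConj ψ)
    have hφ : φ = φ' := LinearMap.ext fun y => by simpa using h' y 0
    have hx : x = x' := (Module.bijective_dual_eval K A.carrier).1 <| LinearMap.ext fun ψ => by
      simpa using h' 0 ψ
    rw [hφ, hx]
  · intro Φ
    -- conjugating the values of `Φ` on the second factor gives a linear form on the dual of `A`, that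
    -- is, the evaluation at a vector `x`
    let Ψ : Module.Dual K (Module.Dual K A.carrier) :=
      { toFun := fun ψ => IsCMField.complexConj K (Φ (0, A.dual.toConj ψ))
        map_add' := fun ψ ψ' => by
          have : ((0 : A.carrier), A.dual.toConj (ψ + ψ')) =
              ((0 : A.carrier), A.dual.toConj ψ) + ((0 : A.carrier), A.dual.toConj ψ') := by
            rw [Prod.mk_add_mk, add_zero]
            rfl
          rw [this, map_add, map_add]
        map_smul' := fun a ψ => by
          have : ((0 : A.carrier), A.dual.toConj (a • ψ)) =
              IsCMField.complexConj K a • ((0 : A.carrier), A.dual.toConj ψ) := by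
            rw [Prod.smul_mk, smul_zero, conj_smul, IsCMField.complexConj_apply_apply]
            rfl
          rw [this, map_smul]
          simp }
    obtain ⟨x, hx⟩ := (Module.bijective_dual_eval K A.carrier).2 Ψ
    refine ⟨(x, Φ ∘ₗ LinearMap.inl K A.carrier A.dual.ConjCarrier), conjPairing_ext fun y ψ => ?_⟩
    have h1 : ψ x = IsCMField.complexConj K (Φ (0, A.dual.toConj ψ)) := LinearMap.congr_fun hx ψ
    rw [conjPairing_apply, h1, IsCMField.complexConj_apply_apply, LinearMap.comp_apply,
      LinearMap.inl_apply, ← map_add]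
    simp

/-- Over a CM field, the sum of a space and of any rescaling of its conjugate dual is similar to its
own conjugate dual. -/
theorem isSimilarity_conjSwap (A : RigidAdelicSpace.{u, v} K) {t : ℝ} (ht : 0 < t) :
    IsSimilarity (conjSwap A ht) := by
  refine isSimilarity_of_bijective (A.conjPairing_bijective) ?_ (inv_pos.mpr ht) ?_
  · rintro ⟨x, φ⟩
    have h := A.forall_pairing_integral_iff (g := IsCMField.complexConj K) (map_zero _) (fun k => by
      refine ⟨fun ⟨a, ha⟩ => ⟨IsCMField.ringOfIntegersComplexConj K a, ?_⟩,
        fun ⟨a, ha⟩ => ⟨IsCMField.ringOfIntegersComplexConj K a, ?_⟩⟩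
      · rw [← IsCMField.complexConj_apply_apply K k, ha]
        rfl
      · rw [ha]
        rfl) x φ
    refine Iff.trans ⟨fun H y hy ψ hψ => H (y, A.dual.toConj ψ) ⟨hy, hψ⟩, fun H z hz => ?_⟩ h
    exact H z.1 hz.1 (A.dual.toConj.symm z.2) hz.2
  · rintro γ ⟨x, φ⟩
    set φ' : Module.Dual K A.carrier := A.dual.toConj.symm φ with hφ'
    let γ' := ComplexEmbedding.conjugate γ
    have h1 := (dual_directSum_herm (A := A) (B := A.dual.conjugate) (ht := ht) γ' φ' φ'
      (conjDual (A := A.dual) (Module.Dual.eval K A.carrier x))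
      (conjDual (A := A.dual) (Module.Dual.eval K A.carrier x))).trans
        (congrArg (fun r => A.dual.herm γ' φ' φ' + (t : ℂ)⁻¹ * r)
          ((dual_conjugate_herm A.dual γ' _ _).trans (dual_dual_herm A _ x x)))
    have hγ : ComplexEmbedding.conjugate γ' = γ := star_involutive γ
    rw [hγ] at h1
    have h2 : A.dual.herm γ' φ' φ' + (t : ℂ)⁻¹ * A.herm γ x x =
        ((t⁻¹ : ℝ) : ℂ) * (A.herm γ x x + (t : ℂ) * A.dual.herm γ' φ' φ') := by
      have ht' : (t : ℂ) ≠ 0 := by exact_mod_cast ht.ne'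
      push_cast
      field_simp
      ring
    exact (congrArg Complex.re (h1.trans h2)).trans (Complex.re_ofReal_mul _ _)

theorem isUnitary_directSum_dual_conjugate (A : RigidAdelicSpace.{u, v} K) {t : ℝ} (ht : 0 < t) :
    (directSum A A.dual.conjugate t ht).IsUnitary := by
  refine ⟨conjSwap A ht, isSimilarity_conjSwap A ht, ?_⟩
  rintro ⟨x, φ⟩ ⟨y, ψ⟩
  refine (conjForm_conjSwap A ht y x (A.dual.toConj.symm ψ) (A.dual.toConj.symm φ)).trans ?_
  refine Eq.trans ?_ (congrArg (IsCMField.complexConj K)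
    (conjForm_conjSwap A ht x y (A.dual.toConj.symm φ) (A.dual.toConj.symm ψ)).symm)
  rw [map_add, IsCMField.complexConj_apply_apply, add_comm]

end Conjugate

end RigidAdelicSpace

theorem proposition3p8 {K : Type u} [Field K] [NumberField K]
    (F : RigidAdelicSpace.{u, v} K) (hF : Nontrivial F.carrier) :
    List.TFAE [
      ∀ E : RigidAdelicSpace.{u, u} K, Nontrivial E.carrier →
        (E.tensor F).minHeight = E.minHeight * F.minHeight,
      ∀ E : RigidAdelicSpace.{u, u} K, Nontrivial E.carrier → E.IsIsodual →
        (E.tensor F).minHeight = E.minHeight * F.minHeight,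
      ∀ E : RigidAdelicSpace.{u, u} K, Nontrivial E.carrier → E.IsOrthogonal →
        (E.tensor F).minHeight = E.minHeight * F.minHeight,
      ∀ E : RigidAdelicSpace.{u, u} K, Nontrivial E.carrier → E.IsSymplectic →
        (E.tensor F).minHeight = E.minHeight * F.minHeight] ∧
    (∀ _ : NumberField.IsCMField K,
      ((∀ E : RigidAdelicSpace.{u, u} K, Nontrivial E.carrier →
          (E.tensor F).minHeight = E.minHeight * F.minHeight) ↔
        ∀ E : RigidAdelicSpace.{u, u} K, Nontrivial E.carrier → E.IsUnitary →
          (E.tensor F).minHeight = E.minHeight * F.minHeight)) := by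
  have hdual : ∀ E : RigidAdelicSpace.{u, u} K, Nontrivial E.carrier →
      Nontrivial E.dual.carrier := fun E _ =>
    inferInstanceAs (Nontrivial (Module.Dual K E.carrier))
  have hsum : ∀ (E : RigidAdelicSpace.{u, u} K) (B : RigidAdelicSpace.{u, u} K) (t : ℝ)
      (ht : 0 < t), Nontrivial E.carrier → Nontrivial (RigidAdelicSpace.directSum E B t ht).carrier :=
    fun E B t ht _ => inferInstanceAs (Nontrivial (E.carrier × B.carrier))
  constructor
  · tfae_have 1 → 2 := fun h E hE _ => h E hE
    tfae_have 2 → 3 := fun h E hE ⟨σ, hσ, _⟩ => h E hE ⟨σ, hσ⟩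
    tfae_have 2 → 4 := fun h E hE ⟨σ, hσ, _⟩ => h E hE ⟨σ, hσ⟩
    tfae_have 3 → 1 := fun h E hE =>
      have := hdual E hE
      RigidAdelicSpace.minHeight_tensor_of_directSum E E.dual F fun t ht =>
        h _ (hsum E E.dual t ht hE) (RigidAdelicSpace.isOrthogonal_directSum_dual E ht)
    tfae_have 4 → 1 := fun h E hE =>
      have := hdual E hE
      RigidAdelicSpace.minHeight_tensor_of_directSum E E.dual F fun t ht =>
        h _ (hsum E E.dual t ht hE) (RigidAdelicSpace.isSymplectic_directSum_dual E ht)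
    tfae_finish
  · intro _
    refine ⟨fun h E hE _ => h E hE, fun h E hE => ?_⟩
    have : Nontrivial E.dual.conjugate.carrier := hdual E hE
    exact RigidAdelicSpace.minHeight_tensor_of_directSum E E.dual.conjugate F fun t ht =>
      h _ (hsum E E.dual.conjugate t ht hE) (RigidAdelicSpace.isUnitary_directSum_dual_conjugate E ht)
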